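/- Setting. Let $Z_1,\dots,Z_n$ ($n\ge 1$) be i.i.d. copies of a random element $Z$, let $X$ be a (measurable) function of $Z$, and let $\mathbb{E}_n$ denote the average over the sample. Write $\|g\|_2=\sqrt{\mathbb{E}[g(X)^2]}$. Let $m(Z;f)$ be linear in the function $f$. For a class $G$ of functions let $\mathcal{R}(G)=\mathbb{E}\big[\sup_{g\in G}\frac1n\sum_{i=1}^n\epsilon_i\, g(Z_i)\big]$ be its Rademacher complexity, with $\epsilon_i$ independent uniform signs (for functions of $X$, $g(Z_i)$ is $g(X_i)$). For a class $\mathcal{F}$ let $\mathrm{span}_\kappa(\mathcal{F})=\{\sum_{i=1}^{p} w_i f_i: f_i\in\mathcal{F},\ \|w\|_1\le\kappa,\ p\le\infty\}$. Let $\mathcal{F}=\bigcup_{i=1}^d\mathcal{F}^i$, $d\ge1$, where each $\mathcal{F}^i$ is a non-empty class of functions of $X$ that is symmetric ($f\in\mathcal{F}^i\Rightarrow -f\in\mathcal{F}^i$), and let $m\circ\mathcal{F}^i=\{m(\cdot;f):f\in\mathcal{F}^i\}$. Let $\mathcal{A}$ be a class of functions of $X$ with a norm $\|\cdot\|_{\mathcal{A}}$,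 star-convex about $0$ ($ra\in\mathcal{A}$ for $a\in\mathcal{A}$, $r\in[0,1]$), and let $\mathcal{A}_B=\{a\in\mathcal{A}:\|a\|_{\mathcal{A}}^2\le B\}$. Let $a_0\in\mathcal{A}$ be a Riesz representer: $\mathbb{E}[m(Z;f)]=\mathbb{E}[a_0(X)f(X)]$ for all $f\in\mathcal{F}$. Suppose that the functions in $\mathcal{F}$ and in $m\circ\mathcal{F}$, and the functions $a\in\mathcal{A}$ with $\|a\|_{\mathcal{A}}\le\|a_0\|_{\mathcal{A}}+1$, take values in $[-1,1]$, and that all these classes are pointwise measurable (measurable functions, with countable subclasses that are sequentially dense for pointwise convergence). Theorem. There are universal constants $c_0>0$, $c_1\ge1$ such that the following holds in every such setting. Let $\zeta\in(0,1)$, let $$\delta_{n,\zeta}:=2\max_{1\le i\le d}\big(\mathcal{R}(\mathcal{F}^i)+\mathcal{R}(m\circ\mathcal{F}^i)\big)+c_0\sqrt{\frac{\log(c_1 d/\zeta)}{n}},$$ let $\lambda\ge\delta_{n,\zeta}$, let $B_{n,\lambda,\zeta}:=(\|a_0\|_{\mathcal{A}}+\delta_{n,\zeta}/\lambda)^2$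 and let $\kappa\ge1$ be such that $$\frac{a-a_0}{\|a-a_0\|_2}\in\mathrm{span}_\kappa(\mathcal{F})\quad\text{for all } a\in\mathcal{A}_{B_{n,\lambda,\zeta}}\text{ with }\|a-a_0\|_2\ge\delta_{n,\zeta}$$ (as functions of $X$, up to almost sure equality). Then every estimator $$\hat a\in\operatorname*{argmin}_{a\in\mathcal{A}}\ \sup_{f\in\mathcal{F}}\mathbb{E}_n[m(Z;f)-a(X)f(X)]+\lambda\|a\|_{\mathcal{A}}$$ satisfies, with probability at least $1-\zeta$, $$\|\hat a-a_0\|_2\le\kappa\Big(4\big(\|a_0\|_{\mathcal{A}}+1\big)\,\mathcal{R}(\mathcal{A}_1)+3\,\delta_{n,\zeta}+\lambda\big(\|a_0\|_{\mathcal{A}}-\|\hat a\|_{\mathcal{A}}\big)\Big).$$ -/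

import Mathlib

open MeasureTheory ProbabilityTheory Filter Topology

noncomputable section

namespace AdvRiesz

/-- Empirical average of `g` over a sample `z` of size `n`. -/
def empAvg {𝒵 : Type*} {n : ℕ} (z : Fin n → 𝒵) (g : 𝒵 → ℝ) : ℝ :=
  (n : ℝ)⁻¹ * ∑ i, g (z i)

/-- The population norm `‖g‖₂ = √ E[g(X)²]`, where `Z ∼ μ` and `X` is a function of `Z`. -/
def l2norm {𝒵 𝒳 : Type*} [MeasurableSpace 𝒵] (μ : Measure 𝒵) (X : 𝒵 → 𝒳) (g : 𝒳 → ℝ) : ℝ :=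
  √(∫ z, g (X z) ^ 2 ∂μ)

/-- The value in `{-1, 1}` of a fair coin. -/
def sgn (b : Bool) : ℝ := if b then 1 else -1

/-- The Rademacher complexity `E sup_{g ∈ G} (1/n) ∑ ε_i g(Z_i)`, for `Z_1, …, Z_n` i.i.d. of
law `μ` and independent uniform signs `ε_1, …, ε_n`. -/
def rademacher {𝒵 : Type*} [MeasurableSpace 𝒵] (μ : Measure 𝒵) (n : ℕ) (G : Set (𝒵 → ℝ)) : ℝ :=
  ∫ z : Fin n → 𝒵,
    (2 ^ n : ℝ)⁻¹ * ∑ ε : Fin n → Bool,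
      sSup ((fun g : 𝒵 → ℝ => (n : ℝ)⁻¹ * ∑ i, sgn (ε i) * g (z i)) '' G)
    ∂(Measure.pi fun _ : Fin n => μ)

/-- A class of functions with a countable subclass whose sequences reach, by pointwise
convergence, every member of the class: then suprema over the class are measurable. -/
def PointwiseSeparable {α : Type*} (G : Set (α → ℝ)) : Prop :=
  ∃ D ⊆ G, D.Countable ∧ ∀ g ∈ G, ∃ u : ℕ → α → ℝ,
    (∀ k, u k ∈ D) ∧ ∀ x, Tendsto (fun k => u k x) atTop (𝓝 (g x))

variable {𝒵 𝒳 : Type*}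

/-- The functions of `𝒮`, seen as functions of `Z` through `X`. -/
def compX (X : 𝒵 → 𝒳) {V : Submodule ℝ (𝒳 → ℝ)} (𝒮 : Set V) : Set (𝒵 → ℝ) :=
  (fun (f : V) (z : 𝒵) => (f : 𝒳 → ℝ) (X z)) '' 𝒮

/-- The class `m ∘ 𝒮 = {m(·; f) : f ∈ 𝒮}`. -/
def mComp {𝒢 : Submodule ℝ (𝒳 → ℝ)} (m : 𝒵 → 𝒢 →ₗ[ℝ] ℝ) (𝒮 : Set 𝒢) : Set (𝒵 → ℝ) :=
  (fun (f : 𝒢) (z : 𝒵) => m z f) '' 𝒮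

/-- `𝒜_B = {a ∈ 𝒜 : ‖a‖_𝒜² ≤ B}`. -/
def sub {V : Submodule ℝ (𝒳 → ℝ)} (p : Seminorm ℝ V) (𝒜 : Set V) (B : ℝ) : Set V :=
  {a | a ∈ 𝒜 ∧ p a ^ 2 ≤ B}

/-- `span_κ(ℱ)`: the sums `∑ w_i f_i`, finite or infinite, with `f_i ∈ ℱ` and `‖w‖₁ ≤ κ`
(a finite sum is one whose remaining weights vanish). -/
def spanK {𝒢 : Submodule ℝ (𝒳 → ℝ)} (κ : ℝ) (ℱ : Set 𝒢) : Set (𝒳 → ℝ) :=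
  {g | ∃ (w : ℕ → ℝ) (f : ℕ → 𝒢), (∀ i, f i ∈ ℱ) ∧ Summable (fun i => |w i|) ∧
    ∑' i, |w i| ≤ κ ∧ ∀ x, HasSum (fun i => w i * (f i : 𝒳 → ℝ) x) (g x)}

/-- The criterion `sup_{f ∈ ℱ} 𝔼_n[m(Z; f) - a(X) f(X)] + lam ‖a‖_𝒜`. -/
def criterion (X : 𝒵 → 𝒳) {𝒢 V : Submodule ℝ (𝒳 → ℝ)} (m : 𝒵 → 𝒢 →ₗ[ℝ] ℝ) (ℱ : Set 𝒢)
    (p : Seminorm ℝ V) (lam : ℝ) {n : ℕ} (z : Fin n → 𝒵) (a : V) : ℝ :=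
  sSup ((fun f : 𝒢 =>
      empAvg z fun y => m y f - (a : 𝒳 → ℝ) (X y) * (f : 𝒳 → ℝ) (X y)) '' ℱ) + lam * p a

/-- `a` minimizes the criterion over `𝒜`. -/
def IsEstimate (X : 𝒵 → 𝒳) {𝒢 V : Submodule ℝ (𝒳 → ℝ)} (m : 𝒵 → 𝒢 →ₗ[ℝ] ℝ) (ℱ : Set 𝒢)
    (𝒜 : Set V) (p : Seminorm ℝ V) (lam : ℝ) {n : ℕ} (z : Fin n → 𝒵) (a : V) : Prop :=
  a ∈ 𝒜 ∧ ∀ b ∈ 𝒜, criterion X m ℱ p lam z a ≤ criterion X m ℱ p lam z b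

/-- `δ_{n,ζ} = 2 max_i (R(ℱ^i) + R(m ∘ ℱ^i)) + c₀ √(log(c₁ d / ζ) / n)`. -/
def delta [MeasurableSpace 𝒵] (μ : Measure 𝒵) (X : 𝒵 → 𝒳) {𝒢 : Submodule ℝ (𝒳 → ℝ)}
    (m : 𝒵 → 𝒢 →ₗ[ℝ] ℝ) {d : ℕ} (F : Fin d → Set 𝒢) (n : ℕ) (ζ c₀ c₁ : ℝ) : ℝ :=
  2 * (⨆ i : Fin d, (rademacher μ n (compX X (F i)) + rademacher μ n (mComp m (F i)))) +
    c₀ * √(Real.log (c₁ * d / ζ) / n)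

end AdvRiesz

end

/-! The proof splits into a deterministic inequality and a uniform deviation bound.

On a good sample, comparing `ahat` with `a₀` in the criterion bounds every empirical moment of m(f)
- ahat f by δ + λ(‖a₀‖ - ‖ahat‖). The test class is symmetric, so the supremum of these moments is
nonnegative; hence ‖ahat‖ ≤ ‖a₀‖ + δ/λ ≤ ‖a₀‖ + 1, and deviations matter only over that ball. There
the Riesz identity turns E[m(f) - ahat f] into E[(a₀ - ahat) f], which is therefore at most some K
for every f. Expanding (ahat - a₀)/‖ahat - a₀‖₂ = ∑ w_i f_i and integrating against ahat - a₀ gives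
‖ahat - a₀‖₂ = ∑ w_i E[(ahat - a₀) f_i] ≤ κ K (`l2norm_le_of_mem_spanK`,
`l2norm_sub_le_of_deviation_le`).

The deviation bound (`exists_deviation_event`) is symmetrization plus bounded differences for the
functions m(f) - a f, once with a = a₀ and once with a ranging over the ball. Contraction removes
the fixed factor a₀; for varying a, polarization bounds the complexity of the products by twice
those of the factors, and star-convexity rescales the ball to the unit ball. Separability reduces
every supremum to a countable one. A union bound over the d classes costs only a logarithm. -/

namespace AdvRiesz

/-! ### Averages over random signs: contraction and products. -/

section Signs

variable {ι : Type*} {n : ℕ}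

/-- The average over signs `ε` of `⨆ t, ∑ i, ε i * v i t`. -/
noncomputable def signAvg (v : Fin n → ι → ℝ) : ℝ :=
  (2 ^ n : ℝ)⁻¹ * ∑ ε : Fin n → Bool, ⨆ t, ∑ i, sgn (ε i) * v i t

theorem abs_sgn (b : Bool) : |sgn b| = 1 := by cases b <;> simp [sgn]

theorem sgn_not (b : Bool) : sgn (!b) = -sgn b := by cases b <;> simp [sgn]

theorem bddAbove_range_of_abs_le {f : ι → ℝ} {C : ℝ} (h : ∀ t, |f t| ≤ C) :
    BddAbove (Set.range f) :=
  ⟨C, by rintro _ ⟨t, rfl⟩; exact (abs_le.1 (h t)).2⟩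

theorem abs_iSup_le_of_abs_le [Nonempty ι] {f : ι → ℝ} {C : ℝ} (h : ∀ t, |f t| ≤ C) :
    |⨆ t, f t| ≤ C := by
  refine abs_le.2 ⟨?_, ciSup_le fun t => (abs_le.1 (h t)).2⟩
  obtain ⟨t⟩ := ‹Nonempty ι›
  exact (abs_le.1 (h t)).1.trans (le_ciSup (bddAbove_range_of_abs_le h) t)

theorem abs_sum_sgn_mul_le {v : Fin n → ℝ} {C : ℝ} (hv : ∀ i, |v i| ≤ C) (ε : Fin n → Bool) :
    |∑ i, sgn (ε i) * v i| ≤ n * C := by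
  refine (Finset.abs_sum_le_sum_abs _ _).trans ?_
  refine (Finset.sum_le_card_nsmul _ _ C fun i _ => ?_).trans (by simp)
  rw [abs_mul, abs_sgn, one_mul]
  exact hv i

/-- The two suprema at s and t involve v only through v s - v t ≤ |u s - u t|. The rest is symmetric
in s and t, so the absolute value can be resolved by exchanging them. -/
theorem iSup_add_iSup_contraction [Nonempty ι] {A u v : ι → ℝ} {C : ℝ} (hA : ∀ t, |A t| ≤ C)
    (hu : ∀ t, |u t| ≤ C) (huv : ∀ s t, |v s - v t| ≤ |u s - u t|) :
    (⨆ t, (A t + v t)) + (⨆ t, (A t - v t)) ≤ (⨆ t, (A t + u t)) + ⨆ t, (A t - u t) := by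
  have hp : BddAbove (Set.range fun t => A t + u t) :=
    bddAbove_range_of_abs_le fun t => (abs_add_le _ _).trans (add_le_add (hA t) (hu t))
  have hm : BddAbove (Set.range fun t => A t - u t) :=
    bddAbove_range_of_abs_le fun t => (abs_sub _ _).trans (add_le_add (hA t) (hu t))
  refine ciSup_add_ciSup_le fun s t => ?_
  have h1 := le_ciSup hp s
  have h2 := le_ciSup hm t
  have h3 := le_ciSup hp t
  have h4 := le_ciSup hm s
  have h5 := (le_abs_self _).trans (huv s t)
  rcases abs_cases (u s - u t) with h | h <;> linarith [h.1]

theorem sum_bool_fin_succ (φ : (Fin (n + 1) → Bool) → ℝ) :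
    ∑ ε, φ ε = ∑ b : Bool, ∑ ε : Fin n → Bool, φ (Fin.cons b ε) := by
  rw [← Fintype.sum_prod_type' (f := fun (b : Bool) (ε : Fin n → Bool) => φ (Fin.cons b ε))]
  exact (Fintype.sum_equiv (Fin.consEquiv fun _ => Bool) _ _ fun _ => rfl).symm

/-- The contraction principle, one coordinate at a time. The extra term `A` makes the induction
work: it absorbs the coordinate set aside while the others are replaced. -/
theorem sum_iSup_contraction [Nonempty ι] {C : ℝ} :
    ∀ {n : ℕ} {K : ℝ} (A : ι → ℝ) (u v : Fin n → ι → ℝ), (∀ t, |A t| ≤ K) →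
      (∀ i t, |u i t| ≤ C) → (∀ i t, |v i t| ≤ C) →
      (∀ i s t, |v i s - v i t| ≤ |u i s - u i t|) →
      ∑ ε : Fin n → Bool, ⨆ t, (A t + ∑ i, sgn (ε i) * v i t) ≤
        ∑ ε : Fin n → Bool, ⨆ t, (A t + ∑ i, sgn (ε i) * u i t) := by
  intro n
  induction n with
  | zero => intro K A u v _ _ _ _; simp
  | succ n ih =>
    intro K A u v hA hu hv huv
    rw [sum_bool_fin_succ, sum_bool_fin_succ]
    have step (b : Bool) : ∑ ε : Fin n → Bool, ⨆ t, (A t + ∑ i, sgn ((Fin.cons b ε :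
          Fin (n + 1) → Bool) i) * v i t) ≤
        ∑ ε : Fin n → Bool, ⨆ t, (A t + sgn b * v 0 t + ∑ i, sgn (ε i) * u i.succ t) := by
      have := ih (K := K + C) (fun t => A t + sgn b * v 0 t) (fun i => u i.succ)
        (fun i => v i.succ) (fun t => (abs_add_le _ _).trans
          (add_le_add (hA t) (by rw [abs_mul, abs_sgn, one_mul]; exact hv 0 t)))
        (fun i => hu i.succ) (fun i => hv i.succ) (fun i => huv i.succ)
      simpa [Fin.sum_univ_succ, add_assoc] using this
    refine (Finset.sum_le_sum fun b _ => step b).trans ?_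
    simp only [Fintype.sum_bool, ← Finset.sum_add_distrib]
    refine Finset.sum_le_sum fun ε _ => ?_
    -- The two-point lemma wants one bound for both `A` and `u`; for n = 0 the first entry of the
    -- maximum need not dominate C.
    have hB (t : ι) : |A t + ∑ i, sgn (ε i) * u i.succ t| ≤ max (K + n * C) C :=
      ((abs_add_le _ _).trans (add_le_add (hA t)
        (abs_sum_sgn_mul_le (fun i => hu i.succ t) ε))).trans (le_max_left _ _)
    have := iSup_add_iSup_contraction (u := u 0) (v := v 0) hB
      (fun t => (hu 0 t).trans (le_max_right _ _)) (huv 0)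
    simp only [Fin.sum_univ_succ, Fin.cons_zero, Fin.cons_succ, sgn]
    simp only [Bool.false_eq_true, if_true, if_false, one_mul, neg_mul, sgn] at this ⊢
    convert this using 3 <;> first | rfl | exact funext fun t => by ring

theorem signAvg_contraction [Nonempty ι] {C : ℝ} {u v : Fin n → ι → ℝ}
    (hu : ∀ i t, |u i t| ≤ C) (hv : ∀ i t, |v i t| ≤ C)
    (huv : ∀ i s t, |v i s - v i t| ≤ |u i s - u i t|) : signAvg v ≤ signAvg u := by
  have := sum_iSup_contraction (K := 0) (fun _ => 0) u v (by simp) hu hv huv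
  simp only [zero_add] at this
  exact mul_le_mul_of_nonneg_left this (by positivity)

theorem sum_iSup_neg (v : Fin n → ι → ℝ) :
    ∑ ε : Fin n → Bool, ⨆ t, ∑ i, -sgn (ε i) * v i t =
      ∑ ε : Fin n → Bool, ⨆ t, ∑ i, sgn (ε i) * v i t := by
  refine Fintype.sum_equiv (Equiv.piCongrRight fun _ => Equiv.boolNot) _ _ fun ε => ?_
  simp [sgn_not]

theorem signAvg_neg (v : Fin n → ι → ℝ) : signAvg (fun i t => -v i t) = signAvg v := by
  rw [signAvg, signAvg, ← sum_iSup_neg v]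
  simp

theorem signAvg_le_add [Nonempty ι] {κ₁ κ₂ : Type*} {C : ℝ} {v : Fin n → ι → ℝ}
    {u : Fin n → κ₁ → ℝ} {w : Fin n → κ₂ → ℝ} (f : ι → κ₁) (g : ι → κ₂)
    (hu : ∀ i t, |u i t| ≤ C) (hw : ∀ i t, |w i t| ≤ C)
    (h : ∀ i t, v i t = u i (f t) + w i (g t)) : signAvg v ≤ signAvg u + signAvg w := by
  rw [signAvg, signAvg, signAvg, ← mul_add, ← Finset.sum_add_distrib]
  refine mul_le_mul_of_nonneg_left (Finset.sum_le_sum fun ε _ => ciSup_le fun t => ?_)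
    (by positivity)
  simp only [h, mul_add, Finset.sum_add_distrib]
  exact add_le_add
    (le_ciSup (f := fun t => ∑ i, sgn (ε i) * u i t)
      (bddAbove_range_of_abs_le fun t => abs_sum_sgn_mul_le (fun i => hu i t) ε) (f t))
    (le_ciSup (f := fun t => ∑ i, sgn (ε i) * w i t)
      (bddAbove_range_of_abs_le fun t => abs_sum_sgn_mul_le (fun i => hw i t) ε) (g t))

theorem abs_signAvg_le [Nonempty ι] {C : ℝ} {v : Fin n → ι → ℝ} (hv : ∀ i t, |v i t| ≤ C) :
    |signAvg v| ≤ n * C := by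
  rw [signAvg, abs_mul, abs_of_pos (by positivity : (0 : ℝ) < (2 ^ n)⁻¹),
    inv_mul_le_iff₀ (by positivity)]
  refine (Finset.abs_sum_le_sum_abs _ _).trans ?_
  refine (Finset.sum_le_card_nsmul _ _ (n * C) fun ε _ =>
    abs_iSup_le_of_abs_le fun t => abs_sum_sgn_mul_le (fun i => hv i t) ε).trans (by simp)

/-- The class `{a f}` is controlled by the classes `{a}` and `{f}`. -/
theorem signAvg_mul_le {κ : Type*} [Nonempty ι] [Nonempty κ] {u : Fin n → ι → ℝ}
    {w : Fin n → κ → ℝ} (hu : ∀ i t, |u i t| ≤ 1) (hw : ∀ i t, |w i t| ≤ 1) :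
    signAvg (fun i (t : ι × κ) => u i t.1 * w i t.2) ≤ 2 * signAvg u + 2 * signAvg w := by
  have hadd (i) (t : ι × κ) : |u i t.1 + w i t.2| ≤ 2 := by
    linarith [abs_add_le (u i t.1) (w i t.2), hu i t.1, hw i t.2]
  have hsub (i) (t : ι × κ) : |u i t.1 - w i t.2| ≤ 2 := by
    linarith [abs_sub (u i t.1) (w i t.2), hu i t.1, hw i t.2]
  have hsq {x : ℝ} (hx : |x| ≤ 2) : |x ^ 2 / 4| ≤ 2 := by
    rw [abs_of_nonneg (by positivity)]
    nlinarith [abs_nonneg x, sq_abs x]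
  have hlip {x y : ℝ} (hx : |x| ≤ 2) (hy : |y| ≤ 2) : |x ^ 2 / 4 - y ^ 2 / 4| ≤ |x - y| := by
    have : x ^ 2 / 4 - y ^ 2 / 4 = (x - y) * ((x + y) / 4) := by ring
    rw [this, abs_mul]
    refine mul_le_of_le_one_right (abs_nonneg _) ?_
    rw [abs_div, abs_of_pos (by norm_num : (0 : ℝ) < 4)]
    linarith [abs_add_le x y]
  -- Polarization: xy = (x + y)²/4 - (x - y)²/4, and x²/4 is 1-Lipschitz on [-2, 2].
  have h1 : signAvg (fun i (t : ι × κ) => u i t.1 * w i t.2) ≤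
      signAvg (fun i (t : ι × κ) => (u i t.1 + w i t.2) ^ 2 / 4) +
        signAvg (fun i (t : ι × κ) => -((u i t.1 - w i t.2) ^ 2 / 4)) :=
    signAvg_le_add (C := 2) id id (fun i t => hsq (hadd i t))
      (fun i t => by rw [abs_neg]; exact hsq (hsub i t)) (fun i t => by dsimp; ring)
  rw [signAvg_neg] at h1
  have h2 := signAvg_contraction (fun i t => hadd i t) (fun i t => hsq (hadd i t))
    (fun i s t => hlip (hadd i s) (hadd i t))
  have h3 := signAvg_contraction (fun i t => hsub i t) (fun i t => hsq (hsub i t))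
    (fun i s t => hlip (hsub i s) (hsub i t))
  have h4 : signAvg (fun i (t : ι × κ) => u i t.1 + w i t.2) ≤ signAvg u + signAvg w :=
    signAvg_le_add Prod.fst Prod.snd hu hw fun _ _ => rfl
  have h5 : signAvg (fun i (t : ι × κ) => u i t.1 - w i t.2) ≤ signAvg u + signAvg w := by
    rw [← signAvg_neg w]
    exact signAvg_le_add (C := 1) Prod.fst Prod.snd hu (fun i t => by rw [abs_neg]; exact hw i t)
      fun _ _ => sub_eq_add_neg _ _
  linarith

end Signs

/-! ### Concentration for functions of independent variables. -/

section BoundedDifferences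

variable {𝒵 : Type*} [MeasurableSpace 𝒵]

theorem integrable_of_abs_le {α : Type*} [MeasurableSpace α] {ν : Measure α} [IsFiniteMeasure ν]
    {f : α → ℝ} {C : ℝ} (hf : Measurable f) (hC : ∀ x, |f x| ≤ C) : Integrable f ν :=
  Integrable.of_bound hf.aestronglyMeasurable C (.of_forall hC)

theorem abs_integral_le_of_abs_le {α : Type*} [MeasurableSpace α] {ν : Measure α}
    [IsProbabilityMeasure ν] {f : α → ℝ} {C : ℝ} (hC : ∀ x, |f x| ≤ C) : |∫ x, f x ∂ν| ≤ C := by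
  simpa using norm_integral_le_of_norm_le_const (μ := ν) (f := f) (.of_forall hC)

theorem measurable_cons (n : ℕ) :
    Measurable fun q : 𝒵 × (Fin n → 𝒵) => (Fin.cons q.1 q.2 : Fin (n + 1) → 𝒵) := by
  refine measurable_pi_lambda _ fun i => ?_
  refine Fin.cases ?_ (fun j => ?_) i
  · simpa using measurable_fst
  · simpa using! (measurable_pi_apply j).comp measurable_snd

theorem integral_pi_succ (μ : Measure 𝒵) [IsProbabilityMeasure μ] {n : ℕ}
    {f : (Fin (n + 1) → 𝒵) → ℝ} (hf : Integrable f (Measure.pi fun _ => μ)) :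
    ∫ z, f z ∂(Measure.pi fun _ : Fin (n + 1) => μ) =
      ∫ x, ∫ z, f (Fin.cons x z) ∂(Measure.pi fun _ : Fin n => μ) ∂μ := by
  have h := (measurePreserving_piFinSuccAbove (fun _ : Fin (n + 1) => μ) 0).symm
  have h1 := h.integral_comp' f
  have h2 := (h.integrable_comp_emb (MeasurableEquiv.measurableEmbedding _)).2 hf
  rw [← h1]
  refine (integral_prod _ h2).trans ?_
  simp [MeasurableEquiv.piFinSuccAbove_symm_apply, Fin.insertNthEquiv]

/-- **Bounded differences**: a function of independent variables, each of which moves it by at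
most `c`, has a sub-Gaussian moment generating function. -/
theorem integral_exp_le_of_bounded_differences (μ : Measure 𝒵) [IsProbabilityMeasure μ]
    (c s : ℝ) (hc : 0 ≤ c) : ∀ {n : ℕ} {f : (Fin n → 𝒵) → ℝ} {C : ℝ}, Measurable f →
      (∀ z, |f z| ≤ C) → (∀ z i x, |f (Function.update z i x) - f z| ≤ c) →
      ∫ z, Real.exp (s * (f z - ∫ y, f y ∂(Measure.pi fun _ => μ))) ∂(Measure.pi fun _ => μ) ≤
        Real.exp (n * (c ^ 2 * s ^ 2 / 2)) := by
  intro n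
  induction n with
  | zero =>
    intro f C hf hC _
    have h (z : Fin 0 → 𝒵) : f z = f Fin.elim0 := congrArg f (Subsingleton.elim _ _)
    simp [h]
  | succ n ih =>
    intro f C hf hC hd
    set ν := Measure.pi fun _ : Fin n => μ
    set g : 𝒵 → ℝ := fun x => ∫ z, f (Fin.cons x z) ∂ν
    -- Here `g` is the conditional mean given the first variable: the induction hypothesis handles f
    -- - g, and Hoeffding's lemma handles g minus its mean.
    have hfc : Measurable fun q : 𝒵 × (Fin n → 𝒵) => f (Fin.cons q.1 q.2) := hf.comp (measurable_cons n)
    have hfx (x : 𝒵) : Measurable fun z : Fin n → 𝒵 => f (Fin.cons x z) :=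
      hfc.comp measurable_prodMk_left
    have hfi (x : 𝒵) : Integrable (fun z : Fin n → 𝒵 => f (Fin.cons x z)) ν :=
      integrable_of_abs_le (hfx x) fun z => hC _
    have hg : Measurable g := (hfc.stronglyMeasurable.integral_prod_right).measurable
    have hgC (x : 𝒵) : |g x| ≤ C := abs_integral_le_of_abs_le fun z => hC _
    have hgd (x y : 𝒵) : |g x - g y| ≤ c := by
      rw [← integral_sub (hfi x) (hfi y)]
      refine abs_integral_le_of_abs_le fun z => ?_
      have := hd (Fin.cons y z) 0 x
      rwa [Fin.update_cons_zero] at this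
    have hmean : ∫ y, f y ∂(Measure.pi fun _ : Fin (n + 1) => μ) = ∫ x, g x ∂μ :=
      integral_pi_succ μ (integrable_of_abs_le hf hC)
    rw [hmean]
    set e := ∫ x, g x ∂μ
    have heC : |e| ≤ C := abs_integral_le_of_abs_le hgC
    have hgi : Integrable g μ := integrable_of_abs_le hg hgC
    have hge (x : 𝒵) : g x - e ∈ Set.Icc (-c) c := by
      refine abs_le.1 ?_
      have : g x - e = ∫ y, (g x - g y) ∂μ := by
        rw [integral_sub (integrable_const _) hgi]; simp [e]
      rw [this]
      exact abs_integral_le_of_abs_le fun y => hgd x y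
    have hexp {a : ℝ} (ha : |a| ≤ C + C) : |Real.exp (s * a)| ≤ Real.exp (|s| * (C + C)) := by
      rw [Real.abs_exp]
      exact Real.exp_le_exp.2 ((le_abs_self _).trans (by rw [abs_mul]; gcongr))
    have hbound {a b : ℝ} (ha : |a| ≤ C) (hb : |b| ≤ C) : |a - b| ≤ C + C :=
      (abs_sub _ _).trans (add_le_add ha hb)
    rw [integral_pi_succ μ (integrable_of_abs_le (by fun_prop)
      fun z => hexp (hbound (hC z) heC))]
    have inner (x : 𝒵) : ∫ z, Real.exp (s * (f (Fin.cons x z) - e)) ∂ν ≤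
        Real.exp (s * (g x - e)) * Real.exp (n * (c ^ 2 * s ^ 2 / 2)) := by
      have h1 (z : Fin n → 𝒵) : Real.exp (s * (f (Fin.cons x z) - e)) =
          Real.exp (s * (g x - e)) * Real.exp (s * (f (Fin.cons x z) - g x)) := by
        rw [← Real.exp_add]; ring_nf
      simp only [h1, integral_const_mul]
      refine mul_le_mul_of_nonneg_left (ih (hfx x) (fun z => hC _) fun z i y => ?_)
        (Real.exp_pos _).le
      have := hd (Fin.cons x z) i.succ y
      rwa [← Fin.cons_update] at this
    have hgexp : Integrable (fun x => Real.exp (s * (g x - e))) μ :=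
      integrable_of_abs_le (by fun_prop) fun x => hexp (hbound (hgC x) heC)
    have hsub := hasSubgaussianMGF_of_mem_Icc_of_integral_eq_zero (μ := μ)
      (X := fun x => g x - e) (by fun_prop) (.of_forall hge)
      (by rw [integral_sub hgi (integrable_const _)]; simp [e])
    have hmgf := hsub.mgf_le s
    -- The interval [-c, c] has length 2c, not c; this is where the constant of McDiarmid's
    -- inequality is lost.
    have hcc : (((‖c - -c‖₊ / 2) ^ 2 : NNReal) : ℝ) = c ^ 2 := by
      push_cast
      rw [Real.norm_eq_abs, abs_of_nonneg (by linarith)]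
      ring
    rw [hcc] at hmgf
    calc ∫ x, ∫ z, Real.exp (s * (f (Fin.cons x z) - e)) ∂ν ∂μ
        ≤ ∫ x, Real.exp (s * (g x - e)) * Real.exp (n * (c ^ 2 * s ^ 2 / 2)) ∂μ := by
          refine integral_mono_of_nonneg (.of_forall fun x =>
            integral_nonneg fun z => (Real.exp_pos _).le) (hgexp.mul_const _) (.of_forall inner)
      _ ≤ Real.exp (c ^ 2 * s ^ 2 / 2) * Real.exp (n * (c ^ 2 * s ^ 2 / 2)) := by
          rw [integral_mul_const]
          exact mul_le_mul_of_nonneg_right hmgf (Real.exp_pos _).le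
      _ = Real.exp ((n + 1 : ℕ) * (c ^ 2 * s ^ 2 / 2)) := by
          rw [← Real.exp_add]; push_cast; ring_nf

/-- **McDiarmid's inequality**, with a suboptimal constant. -/
theorem measure_ge_le_of_bounded_differences (μ : Measure 𝒵) [IsProbabilityMeasure μ]
    {c : ℝ} (hc : 0 ≤ c) {n : ℕ} {f : (Fin n → 𝒵) → ℝ} {C : ℝ} (hf : Measurable f)
    (hC : ∀ z, |f z| ≤ C) (hd : ∀ z i x, |f (Function.update z i x) - f z| ≤ c)
    {ε : ℝ} (hε : 0 ≤ ε) :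
    (Measure.pi fun _ => μ).real {z | ε ≤ f z - ∫ y, f y ∂(Measure.pi fun _ => μ)} ≤
      Real.exp (-ε ^ 2 / (2 * (n * c ^ 2))) := by
  set e := ∫ y, f y ∂(Measure.pi fun _ => μ)
  have heC : |e| ≤ C := abs_integral_le_of_abs_le hC
  have h : HasSubgaussianMGF (fun z => f z - e) (Real.toNNReal (n * c ^ 2))
      (Measure.pi fun _ => μ) := by
    refine ⟨fun s => integrable_of_abs_le (C := Real.exp (|s| * (C + C))) (by fun_prop)
      fun z => ?_, fun s => ?_⟩
    · rw [Real.abs_exp]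
      refine Real.exp_le_exp.2 ((le_abs_self _).trans ?_)
      rw [abs_mul]
      gcongr
      exact (abs_sub _ _).trans (add_le_add (hC z) heC)
    · rw [Real.coe_toNNReal _ (by positivity)]
      refine (integral_exp_le_of_bounded_differences μ c s hc hf hC hd).trans (le_of_eq ?_)
      ring_nf
  have := h.measure_ge_le hε
  rwa [Real.coe_toNNReal _ (by positivity)] at this

end BoundedDifferences

/-! ### Symmetrization and the uniform deviation bound. -/

section Symmetrization

variable {𝒵 ι : Type*} [MeasurableSpace 𝒵] {n : ℕ} {C : ℝ} {h : ι → 𝒵 → ℝ}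

/-- The largest deviation `E h_t - 𝔼_n h_t` over a family of functions. -/
noncomputable def empDev (μ : Measure 𝒵) (h : ι → 𝒵 → ℝ) (z : Fin n → 𝒵) : ℝ :=
  ⨆ t, (∫ y, h t y ∂μ - empAvg z (h t))

/-- The Rademacher complexity of an indexed family of functions. -/
noncomputable def famRad (μ : Measure 𝒵) (n : ℕ) (h : ι → 𝒵 → ℝ) : ℝ :=
  ∫ z : Fin n → 𝒵, (n : ℝ)⁻¹ * signAvg (fun i t => h t (z i)) ∂(Measure.pi fun _ => μ)

theorem measurable_signAvg {α : Type*} [MeasurableSpace α] [Countable ι]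
    {v : α → Fin n → ι → ℝ} (hv : ∀ i t, Measurable fun x => v x i t) :
    Measurable fun x => signAvg (v x) := by
  refine (Finset.measurable_sum _ fun ε _ => Measurable.iSup fun t => ?_).const_mul _
  exact Finset.measurable_sum _ fun i _ => (hv i t).const_mul _

theorem abs_empAvg_le {α : Type*} {z : Fin n → α} {g : α → ℝ} (hn : 0 < n) (hg : ∀ y, |g y| ≤ C) :
    |empAvg z g| ≤ C := by
  have hn' : (0 : ℝ) < n := Nat.cast_pos.2 hn
  rw [empAvg, abs_mul, abs_of_pos (inv_pos.2 hn'), inv_mul_le_iff₀ hn']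
  refine (Finset.abs_sum_le_sum_abs _ _).trans ?_
  exact (Finset.sum_le_card_nsmul _ _ C fun i _ => hg _).trans (by simp)

theorem measurable_empDev [Countable ι] (μ : Measure 𝒵) (hh : ∀ t, Measurable (h t)) :
    Measurable (empDev (n := n) μ h) := by
  refine Measurable.iSup fun t => ?_
  simp only [empAvg]
  have := hh t
  fun_prop

theorem integrable_signAvg [Countable ι] [Nonempty ι] (μ : Measure 𝒵) [IsProbabilityMeasure μ]
    (hh : ∀ t, Measurable (h t)) (hC : ∀ t y, |h t y| ≤ C) :
    Integrable (fun z : Fin n → 𝒵 => (n : ℝ)⁻¹ * signAvg (fun i t => h t (z i)))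
      (Measure.pi fun _ => μ) :=
  (integrable_of_abs_le (measurable_signAvg fun i t => (hh t).comp (measurable_pi_apply i))
    fun _ => abs_signAvg_le fun _ t => hC t _).const_mul _

theorem abs_sub_empAvg_le (μ : Measure 𝒵) [IsProbabilityMeasure μ] (hn : 0 < n)
    (hC : ∀ t y, |h t y| ≤ C) (z : Fin n → 𝒵) (t : ι) :
    |∫ y, h t y ∂μ - empAvg z (h t)| ≤ C + C :=
  (abs_sub _ _).trans (add_le_add (abs_integral_le_of_abs_le (hC t)) (abs_empAvg_le hn (hC t)))

theorem abs_empDev_le [Nonempty ι] (μ : Measure 𝒵) [IsProbabilityMeasure μ] (hn : 0 < n)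
    (hC : ∀ t y, |h t y| ≤ C) (z : Fin n → 𝒵) : |empDev μ h z| ≤ C + C :=
  abs_iSup_le_of_abs_le (abs_sub_empAvg_le μ hn hC z)

/-- Regrouped as n independent pairs, the map is the identity or the swap on each pair, and μ ⊗ μ is
invariant under both. -/
theorem measurePreserving_condSwap (μ : Measure 𝒵) [IsProbabilityMeasure μ] (ε : Fin n → Bool) :
    MeasurePreserving
      (fun q : (Fin n → 𝒵) × (Fin n → 𝒵) =>
        ((fun i => if ε i then q.1 i else q.2 i, fun i => if ε i then q.2 i else q.1 i) :
          (Fin n → 𝒵) × (Fin n → 𝒵)))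
      ((Measure.pi fun _ => μ).prod (Measure.pi fun _ => μ))
      ((Measure.pi fun _ => μ).prod (Measure.pi fun _ => μ)) := by
  have h1 := measurePreserving_arrowProdEquivProdArrow 𝒵 𝒵 (Fin n) (fun _ => μ) fun _ => μ
  have h2 : MeasurePreserving
      (fun (w : Fin n → 𝒵 × 𝒵) i => (if ε i then id else Prod.swap : 𝒵 × 𝒵 → 𝒵 × 𝒵) (w i))
      (Measure.pi fun _ => μ.prod μ) (Measure.pi fun _ => μ.prod μ) := by
    refine measurePreserving_pi (fun _ => μ.prod μ) (fun _ => μ.prod μ)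
      (f := fun i => (if ε i then id else Prod.swap : 𝒵 × 𝒵 → 𝒵 × 𝒵)) fun i => ?_
    cases ε i
    · simpa using Measure.measurePreserving_swap
    · simpa using MeasurePreserving.id _
  convert h1.comp (h2.comp h1.symm) using 1
  funext q
  refine Prod.ext (funext fun i => ?_) (funext fun i => ?_) <;>
  cases hε : ε i <;>
  simp [MeasurableEquiv.arrowProdEquivProdArrow, Equiv.arrowProdEquivProdArrow, hε,
    MeasurableEquiv.symm]

theorem signSup_le {α : Type*} {h : ι → α → ℝ} (hC : ∀ t y, |h t y| ≤ C) (ε : Fin n → Bool)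
    (t : ι) (z : Fin n → α) : ∑ i, sgn (ε i) * h t (z i) ≤ ⨆ t, ∑ i, sgn (ε i) * h t (z i) :=
  le_ciSup (f := fun t => ∑ i, sgn (ε i) * h t (z i))
    (bddAbove_range_of_abs_le fun t => abs_sum_sgn_mul_le (fun i => hC t (z i)) ε) t

/-- **Symmetrization.** -/
theorem integral_empDev_le [Countable ι] [Nonempty ι] (μ : Measure 𝒵) [IsProbabilityMeasure μ]
    (hn : 0 < n) (hh : ∀ t, Measurable (h t)) (hC : ∀ t y, |h t y| ≤ C) :
    ∫ z, empDev μ h z ∂(Measure.pi fun _ : Fin n => μ) ≤ 2 * famRad μ n h := by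
  set ν := Measure.pi fun _ : Fin n => μ with hν
  let S (ε : Fin n → Bool) (q : (Fin n → 𝒵) × (Fin n → 𝒵)) : ℝ :=
    ⨆ t, ∑ i, sgn (ε i) * (h t (q.2 i) - h t (q.1 i))
  let U (ε : Fin n → Bool) (z : Fin n → 𝒵) : ℝ := ⨆ t, ∑ i, sgn (ε i) * h t (z i)
  let N (ε : Fin n → Bool) : Fin n → Bool := fun i => !ε i
  have hsub (t : ι) (x y : 𝒵) : |h t x - h t y| ≤ C + C :=
    (abs_sub _ _).trans (add_le_add (hC t x) (hC t y))
  have hSb (ε : Fin n → Bool) (q : (Fin n → 𝒵) × (Fin n → 𝒵)) (t : ι) : |∑ i, sgn (ε i) * (h t (q.2 i) - h t (q.1 i))| ≤ n * (C + C) :=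
    abs_sum_sgn_mul_le (fun i => hsub t _ _) ε
  have hSm (ε) : Measurable (S ε) := by
    refine Measurable.iSup fun t => ?_
    have := hh t
    fun_prop
  have hSi (ε) : Integrable (S ε) (ν.prod ν) :=
    integrable_of_abs_le (hSm ε) fun q => abs_iSup_le_of_abs_le (hSb ε q)
  have hUm (ε) : Measurable (U ε) := by
    refine Measurable.iSup fun t => ?_
    have := hh t
    fun_prop
  have hUi (ε) : Integrable (U ε) ν :=
    integrable_of_abs_le (hUm ε) fun z => abs_iSup_le_of_abs_le fun t =>
      abs_sum_sgn_mul_le (fun i => hC t (z i)) ε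
  -- Exchanging the two samples where the sign is -1 changes the sign of that difference, so signs
  -- come for free.
  have hswap (ε) : ∫ q, S ε q ∂(ν.prod ν) = ∫ q, S (fun _ => true) q ∂(ν.prod ν) := by
    have hp := measurePreserving_condSwap (n := n) μ ε
    rw [← hν] at hp
    conv_rhs => rw [← hp.map_eq]
    rw [integral_map hp.measurable.aemeasurable (hSm _).aestronglyMeasurable]
    refine integral_congr_ae (.of_forall fun q => ?_)
    refine congrArg iSup (funext fun t : ι => Finset.sum_congr rfl fun i _ => ?_)
    cases hε : ε i <;> simp [sgn, hε]
  -- The mean of h is the expected average over an independent ghost sample, and a supremum of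
  -- expectations is at most the expectation of the supremum.
  have hghost (z : Fin n → 𝒵) : empDev μ h z ≤ (n : ℝ)⁻¹ * ∫ z', S (fun _ => true) (z, z') ∂ν := by
    have hSz : Integrable (fun z' => S (fun _ => true) (z, z')) ν :=
      integrable_of_abs_le ((hSm _).comp measurable_prodMk_left)
        fun z' => abs_iSup_le_of_abs_le (hSb _ (z, z'))
    refine ciSup_le fun t => ?_
    have hsum : ∫ z', ∑ i, (h t (z' i) - h t (z i)) ∂ν = ∑ i, (∫ y, h t y ∂μ - h t (z i)) := by
      have hi (i : Fin n) : Integrable (fun z' : Fin n → 𝒵 => h t (z' i)) ν :=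
        integrable_of_abs_le ((hh t).comp (measurable_pi_apply i)) fun z' => hC t _
      rw [integral_finsetSum (f := fun i (z' : Fin n → 𝒵) => h t (z' i) - h t (z i)) _
        fun i _ => (hi i).sub (integrable_const _)]
      refine Finset.sum_congr rfl fun i _ => ?_
      rw [integral_sub (hi i) (integrable_const _),
        integral_comp_eval (μ := fun _ : Fin n => μ) (hh t).aestronglyMeasurable]
      simp
    have hle : ∑ i, (∫ y, h t y ∂μ - h t (z i)) ≤ ∫ z', S (fun _ => true) (z, z') ∂ν := by
      rw [← hsum]
      refine integral_mono (integrable_of_abs_le (C := n * (C + C)) ?_ fun z' => ?_) hSz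
        fun z' => ?_
      · have := hh t
        fun_prop
      · simpa [sgn] using hSb (fun _ => true) (z, z') t
      · have := le_ciSup (bddAbove_range_of_abs_le (hSb (fun _ => true) (z, z'))) t
        simpa [S, sgn] using this
    refine le_trans ?_ (mul_le_mul_of_nonneg_left hle (by positivity))
    rw [Finset.sum_sub_distrib, mul_sub, empAvg]
    have : (n : ℝ) ≠ 0 := by positivity
    simp [this]
  -- Splitting the supremum puts signs ε on one sample and -ε on the other; summed over ε the two
  -- parts agree, hence the factor 2.
  have hstep (ε : Fin n → Bool) : ∫ q, S (fun _ => true) q ∂(ν.prod ν) ≤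
      ∫ z, U ε z ∂ν + ∫ z, U (N ε) z ∂ν := by
    have h1 : Integrable (fun q : (Fin n → 𝒵) × (Fin n → 𝒵) => U ε q.2) (ν.prod ν) :=
      (hUi ε).comp_snd ν
    have h2 : Integrable (fun q : (Fin n → 𝒵) × (Fin n → 𝒵) => U (N ε) q.1) (ν.prod ν) :=
      (hUi (N ε)).comp_fst ν
    have h3 : ∫ q, (U ε q.2 + U (N ε) q.1) ∂(ν.prod ν) =
        ∫ z, U ε z ∂ν + ∫ z, U (N ε) z ∂ν := by
      rw [integral_add h1 h2, integral_fun_fst, integral_fun_snd]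
      simp
    rw [← hswap ε, ← h3]
    refine integral_mono (hSi ε) (h1.add h2) fun q => ciSup_le fun t => ?_
    refine le_trans (le_of_eq ?_) (add_le_add (signSup_le hC ε t q.2) (signSup_le hC (N ε) t q.1))
    rw [← Finset.sum_add_distrib]
    refine Finset.sum_congr rfl fun i _ => ?_
    simp only [N, sgn_not]
    ring
  have hN : ∑ ε, ∫ z, U (N ε) z ∂ν = ∑ ε, ∫ z, U ε z ∂ν :=
    Fintype.sum_equiv (Equiv.piCongrRight fun _ => Equiv.boolNot) _ _ fun ε => rfl
  have hsum : (2 : ℝ) ^ n * ∫ q, S (fun _ => true) q ∂(ν.prod ν) ≤ 2 * ∑ ε, ∫ z, U ε z ∂ν := by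
    have := Finset.sum_le_sum fun (ε : Fin n → Bool) (_ : ε ∈ Finset.univ) => hstep ε
    rw [Finset.sum_add_distrib, hN] at this
    simp only [Finset.sum_const, Finset.card_univ, Fintype.card_pi, Fintype.card_bool,
      Finset.prod_const, Fintype.card_fin, nsmul_eq_mul] at this
    push_cast at this
    linarith
  have hrad : famRad μ n h = (n : ℝ)⁻¹ * ((2 ^ n : ℝ)⁻¹ * ∑ ε, ∫ z, U ε z ∂ν) := by
    rw [famRad, integral_const_mul]
    simp only [signAvg]
    rw [integral_const_mul, integral_finsetSum _ fun ε _ => hUi ε]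
  have hS : ∫ q, S (fun _ => true) q ∂(ν.prod ν) ≤
      2 * ((2 ^ n : ℝ)⁻¹ * ∑ ε, ∫ z, U ε z ∂ν) := by
    rw [mul_left_comm, ← div_eq_inv_mul, le_div_iff₀ (by positivity), mul_comm]
    exact hsum
  calc ∫ z, empDev μ h z ∂ν
      ≤ ∫ z, (n : ℝ)⁻¹ * ∫ z', S (fun _ => true) (z, z') ∂ν ∂ν :=
        integral_mono (integrable_of_abs_le (measurable_empDev μ hh) fun z =>
            abs_empDev_le μ hn hC z)
          ((hSi _).integral_prod_left.const_mul _) hghost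
    _ = (n : ℝ)⁻¹ * ∫ q, S (fun _ => true) q ∂(ν.prod ν) := by
        rw [integral_const_mul, integral_prod _ (hSi _)]
    _ ≤ (n : ℝ)⁻¹ * (2 * ((2 ^ n : ℝ)⁻¹ * ∑ ε, ∫ z, U ε z ∂ν)) := by gcongr
    _ = 2 * famRad μ n h := by rw [hrad]; ring

theorem abs_empDev_update_sub_le [Nonempty ι] (μ : Measure 𝒵) [IsProbabilityMeasure μ]
    (hn : 0 < n) (hC : ∀ t y, |h t y| ≤ C) (z : Fin n → 𝒵) (i : Fin n) (x : 𝒵) :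
    |empDev μ h (Function.update z i x) - empDev μ h z| ≤ 2 * C / n := by
  have hn' : (0 : ℝ) < n := Nat.cast_pos.2 hn
  have hb (z : Fin n → 𝒵) := bddAbove_range_of_abs_le (abs_sub_empAvg_le μ hn hC z)
  have hd (t : ι) : |empAvg (Function.update z i x) (h t) - empAvg z (h t)| ≤ 2 * C / n := by
    have hs : ∑ j, (h t (Function.update z i x j) - h t (z j)) = h t x - h t (z i) := by
      rw [Finset.sum_eq_single i (fun j _ hj => by simp [hj]) (by simp)]
      simp
    rw [empAvg, empAvg, ← mul_sub, ← Finset.sum_sub_distrib, hs, abs_mul,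
      abs_of_pos (inv_pos.2 hn'), div_eq_inv_mul]
    gcongr
    linarith [abs_sub (h t x) (h t (z i)), hC t x, hC t (z i)]
  refine abs_le.2 ⟨?_, ?_⟩
  · rw [neg_le_sub_iff_le_add]
    refine ciSup_le fun t => ?_
    have := le_ciSup (hb (Function.update z i x)) t
    simp only [empDev] at this ⊢
    linarith [(abs_le.1 (hd t)).2]
  · rw [sub_le_iff_le_add]
    refine ciSup_le fun t => ?_
    have := le_ciSup (hb z) t
    simp only [empDev] at this ⊢
    linarith [(abs_le.1 (hd t)).1]

/-- A uniform deviation bound in terms of the Rademacher complexity. -/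
theorem measure_empDev_ge_le [Countable ι] [Nonempty ι] (μ : Measure 𝒵) [IsProbabilityMeasure μ]
    (hn : 0 < n) (hh : ∀ t, Measurable (h t)) (hC : ∀ t y, |h t y| ≤ C) (hC0 : 0 ≤ C)
    {s : ℝ} (hs : 0 ≤ s) :
    (Measure.pi fun _ => μ).real {z : Fin n → 𝒵 | 2 * famRad μ n h + s ≤ empDev μ h z} ≤
      Real.exp (-s ^ 2 * n / (8 * C ^ 2)) := by
  have hn' : (0 : ℝ) < n := Nat.cast_pos.2 hn
  have := measure_ge_le_of_bounded_differences μ (c := 2 * C / n) (by positivity)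
    (measurable_empDev (n := n) μ hh) (abs_empDev_le μ hn hC)
    (abs_empDev_update_sub_le μ hn hC) hs
  refine (measureReal_mono fun z (hz : 2 * famRad μ n h + s ≤ empDev μ h z) => ?_).trans
    (this.trans (le_of_eq ?_))
  · change s ≤ _
    linarith [integral_empDev_le (n := n) μ hn hh hC]
  · congr 1
    -- For C = 0 both exponents are quotients by zero, hence 0.
    rcases eq_or_ne C 0 with rfl | hC1
    · simp
    · field_simp
      ring

end Symmetrization

/-! ### Passing from classes to countable families. -/

section Families

/-- `g` is a pointwise limit of a sequence of members of the family `h`. -/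
def IsPtLimit {ι α : Type*} (h : ι → α → ℝ) (g : α → ℝ) : Prop :=
  ∃ u : ℕ → ι, ∀ x, Tendsto (fun k => h (u k) x) atTop (𝓝 (g x))

/-- One preimage is chosen per member of the countable subclass. Working with indices lets f and
m(f) follow the same approximating sequence. -/
theorem PointwiseSeparable.exists_countable {α β : Type*} {φ : β → α → ℝ} {S : Set β}
    (hS : PointwiseSeparable (φ '' S)) :
    ∃ D ⊆ S, D.Countable ∧ ∀ b ∈ S, IsPtLimit (fun t : D => φ t) (φ b) := by
  obtain ⟨D', hD', hc, hlim⟩ := hS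
  obtain ⟨D, hDS, hbij⟩ := Set.SurjOn.exists_bijOn_subset (f := φ) (s := S) (t := D') hD'
  refine ⟨D, hDS, hbij.mapsTo.countable_of_injOn hbij.injOn hc, fun b hb => ?_⟩
  obtain ⟨u, hu, hux⟩ := hlim (φ b) ⟨b, hb, rfl⟩
  choose v hv hvu using fun k => hbij.surjOn (hu k)
  exact ⟨fun k => ⟨v k, hv k⟩, fun x => by simpa [hvu] using hux x⟩

variable {𝒵 ι : Type*} {n : ℕ} {C : ℝ} {h : ι → 𝒵 → ℝ} {g : 𝒵 → ℝ}

theorem IsPtLimit.sum_sgn_mul_le (hg : IsPtLimit h g) (hC : ∀ t y, |h t y| ≤ C)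
    (ε : Fin n → Bool) (z : Fin n → 𝒵) :
    ∑ i, sgn (ε i) * g (z i) ≤ ⨆ t, ∑ i, sgn (ε i) * h t (z i) := by
  obtain ⟨u, hu⟩ := hg
  have : Tendsto (fun k => ∑ i, sgn (ε i) * h (u k) (z i)) atTop
      (𝓝 (∑ i, sgn (ε i) * g (z i))) :=
    tendsto_finsetSum _ fun i _ => (hu (z i)).const_mul _
  exact le_of_tendsto' this fun k => signSup_le hC ε (u k) z

theorem sSup_image_eq_of_isPtLimit {G : Set (𝒵 → ℝ)} [Nonempty ι] (hC : ∀ t y, |h t y| ≤ C)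
    (hG : ∀ t, h t ∈ G) (hlim : ∀ g ∈ G, IsPtLimit h g) (ε : Fin n → Bool) (z : Fin n → 𝒵) :
    sSup ((fun g : 𝒵 → ℝ => (n : ℝ)⁻¹ * ∑ i, sgn (ε i) * g (z i)) '' G) =
      (n : ℝ)⁻¹ * ⨆ t, ∑ i, sgn (ε i) * h t (z i) := by
  have hub : (n : ℝ)⁻¹ * (⨆ t, ∑ i, sgn (ε i) * h t (z i)) ∈ upperBounds
      ((fun g : 𝒵 → ℝ => (n : ℝ)⁻¹ * ∑ i, sgn (ε i) * g (z i)) '' G) := by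
    rintro _ ⟨g, hg, rfl⟩
    exact mul_le_mul_of_nonneg_left ((hlim g hg).sum_sgn_mul_le hC ε z) (by positivity)
  refine le_antisymm (csSup_le ?_ hub) ?_
  · exact ⟨_, h (Classical.arbitrary ι), hG _, rfl⟩
  · rw [Real.mul_iSup_of_nonneg (by positivity)]
    exact ciSup_le fun t => le_csSup ⟨_, hub⟩ ⟨h t, hG t, rfl⟩

variable [MeasurableSpace 𝒵]

theorem rademacher_eq_famRad (μ : Measure 𝒵) {G : Set (𝒵 → ℝ)} [Nonempty ι]
    (hC : ∀ t y, |h t y| ≤ C) (hG : ∀ t, h t ∈ G) (hlim : ∀ g ∈ G, IsPtLimit h g) :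
    rademacher μ n G = famRad μ n h := by
  refine integral_congr_ae (.of_forall fun z => ?_)
  simp only [sSup_image_eq_of_isPtLimit hC hG hlim, signAvg, ← Finset.mul_sum]
  ring

/-- For each sign vector, g or -g has a nonnegative value. Boundedness is not needed, as an
unbounded real `sSup` is 0. -/
theorem rademacher_nonneg_of_neg_mem (μ : Measure 𝒵) {G : Set (𝒵 → ℝ)} (hg : g ∈ G)
    (hneg : -g ∈ G) : 0 ≤ rademacher μ n G := by
  refine integral_nonneg fun z => ?_
  refine mul_nonneg (by positivity) (Finset.sum_nonneg fun ε _ => Real.sSup_nonneg' ?_)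
  rcases le_total 0 ((n : ℝ)⁻¹ * ∑ i, sgn (ε i) * g (z i)) with h | h
  · exact ⟨_, ⟨g, hg, rfl⟩, h⟩
  · refine ⟨_, ⟨-g, hneg, rfl⟩, ?_⟩
    simpa using h

theorem IsPtLimit.integral_sub_empAvg_le (hg : IsPtLimit h g) (μ : Measure 𝒵)
    [IsProbabilityMeasure μ] (hn : 0 < n) (hh : ∀ t, Measurable (h t))
    (hC : ∀ t y, |h t y| ≤ C) (z : Fin n → 𝒵) : ∫ y, g y ∂μ - empAvg z g ≤ empDev μ h z := by
  obtain ⟨u, hu⟩ := hg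
  have h1 : Tendsto (fun k => ∫ y, h (u k) y ∂μ) atTop (𝓝 (∫ y, g y ∂μ)) :=
    tendsto_integral_of_dominated_convergence (fun _ => C)
      (fun k => (hh _).aestronglyMeasurable) (integrable_const _)
      (fun k => .of_forall (hC _)) (.of_forall hu)
  have h2 : Tendsto (fun k => empAvg z (h (u k))) atTop (𝓝 (empAvg z g)) :=
    (tendsto_finsetSum _ fun i _ => hu (z i)).const_mul _
  exact le_of_tendsto' (h1.sub h2) fun k =>
    le_ciSup (bddAbove_range_of_abs_le (abs_sub_empAvg_le μ hn hC z)) (u k)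

/-- Multiplication by -a(z_i) is 1-Lipschitz, so contraction removes the fixed factor at no cost. -/
theorem famRad_sub_mul_le [Countable ι] [Nonempty ι] (μ : Measure 𝒵) [IsProbabilityMeasure μ]
    {M f : ι → 𝒵 → ℝ} {a : 𝒵 → ℝ} (hM : ∀ t, Measurable (M t)) (hf : ∀ t, Measurable (f t))
    (ha : Measurable a) (hM1 : ∀ t y, |M t y| ≤ 1) (hf1 : ∀ t y, |f t y| ≤ 1)
    (ha1 : ∀ y, |a y| ≤ 1) :
    famRad μ n (fun t y => M t y - a y * f t y) ≤ famRad μ n M + famRad μ n f := by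
  have haf (t : ι) (y : 𝒵) : |-(a y * f t y)| ≤ 1 := by
    rw [abs_neg, abs_mul]
    exact mul_le_one₀ (ha1 y) (abs_nonneg _) (hf1 t y)
  rw [famRad, famRad, famRad,
    ← integral_add (integrable_signAvg μ hM hM1) (integrable_signAvg μ hf hf1)]
  refine integral_mono (integrable_signAvg (C := 2) μ (h := fun t y => M t y - a y * f t y)
    (fun t => (hM t).sub (ha.mul (hf t))) fun t y => ?_)
    ((integrable_signAvg μ hM hM1).add (integrable_signAvg μ hf hf1)) fun z => ?_
  · rw [sub_eq_add_neg]
    linarith [abs_add_le (M t y) (-(a y * f t y)), hM1 t y, haf t y]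
  · simp only [← mul_add]
    refine mul_le_mul_of_nonneg_left ?_ (by positivity)
    have h1 := signAvg_le_add (C := 1) (v := fun i t => M t (z i) - a (z i) * f t (z i))
      (u := fun i t => M t (z i)) (w := fun i t => -(a (z i) * f t (z i))) id id
      (fun i t => hM1 t _) (fun i t => haf t _) fun i t => sub_eq_add_neg _ _
    refine h1.trans (add_le_add_right (signAvg_contraction (C := 1) (fun i t => hf1 t _)
      (fun i t => haf t _) fun i s t => ?_) _)
    rw [neg_sub_neg, ← mul_sub, abs_mul, abs_sub_comm]
    exact mul_le_of_le_one_left (abs_nonneg _) (ha1 _)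

theorem famRad_sub_mul_prod_le {γ : Type*} [Countable ι] [Nonempty ι] [Countable γ] [Nonempty γ]
    (μ : Measure 𝒵) [IsProbabilityMeasure μ] {M f : ι → 𝒵 → ℝ} {a : γ → 𝒵 → ℝ}
    (hM : ∀ t, Measurable (M t)) (hf : ∀ t, Measurable (f t)) (ha : ∀ t, Measurable (a t))
    (hM1 : ∀ t y, |M t y| ≤ 1) (hf1 : ∀ t y, |f t y| ≤ 1) (ha1 : ∀ t y, |a t y| ≤ 1) :
    famRad μ n (fun (t : γ × ι) y => M t.2 y - a t.1 y * f t.2 y) ≤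
      famRad μ n M + (2 * famRad μ n a + 2 * famRad μ n f) := by
  have haf (t : γ × ι) (y : 𝒵) : |-(a t.1 y * f t.2 y)| ≤ 1 := by
    rw [abs_neg, abs_mul]
    exact mul_le_one₀ (ha1 _ y) (abs_nonneg _) (hf1 _ y)
  have iM := integrable_signAvg (n := n) μ hM hM1
  have ia := integrable_signAvg (n := n) μ ha ha1
  have jf := integrable_signAvg (n := n) μ hf hf1
  have iaf : Integrable (fun z : Fin n → 𝒵 => 2 * ((n : ℝ)⁻¹ * signAvg fun i t => a t (z i)) +
      2 * ((n : ℝ)⁻¹ * signAvg fun i t => f t (z i))) (Measure.pi fun _ => μ) :=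
    (ia.const_mul 2).add (jf.const_mul 2)
  rw [famRad, famRad, famRad, famRad, ← integral_const_mul, ← integral_const_mul,
    ← integral_add (ia.const_mul 2) (jf.const_mul 2),
    ← integral_add iM iaf]
  refine integral_mono (integrable_signAvg (C := 2) μ
    (h := fun (t : γ × ι) y => M t.2 y - a t.1 y * f t.2 y)
    (fun t => (hM t.2).sub ((ha t.1).mul (hf t.2))) fun t y => ?_)
    (iM.add iaf) fun z => ?_
  · rw [sub_eq_add_neg]
    linarith [abs_add_le (M t.2 y) (-(a t.1 y * f t.2 y)), hM1 t.2 y, haf t y]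
  · have h1 := signAvg_le_add (C := 1)
      (v := fun i (t : γ × ι) => M t.2 (z i) - a t.1 (z i) * f t.2 (z i))
      (u := fun i t => M t (z i)) (w := fun i (t : γ × ι) => -(a t.1 (z i) * f t.2 (z i)))
      Prod.snd id (fun i t => hM1 t _) (fun i t => haf t _) fun i t => sub_eq_add_neg _ _
    rw [signAvg_neg] at h1
    have h2 := signAvg_mul_le (u := fun i t => a t (z i)) (w := fun i t => f t (z i))
      (fun i t => ha1 t _) fun i t => hf1 t _
    have h3 := mul_le_mul_of_nonneg_left (h1.trans (add_le_add_right h2 _))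
      (by positivity : (0 : ℝ) ≤ (n : ℝ)⁻¹)
    refine h3.trans (le_of_eq ?_)
    ring

/-- Limits are allowed because rescaled members of one countable family need only be approximable by
the other, not belong to it. -/
theorem famRad_le_mul {γ : Type*} [Countable ι] [Nonempty ι] [Countable γ] [Nonempty γ]
    (μ : Measure 𝒵) [IsProbabilityMeasure μ] {C' r : ℝ} {a : γ → 𝒵 → ℝ} (hr : 0 ≤ r)
    (hh : ∀ t, Measurable (h t)) (hC : ∀ t y, |h t y| ≤ C)
    (ha : ∀ t, Measurable (a t)) (hC' : ∀ t y, |a t y| ≤ C')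
    (hlim : ∀ t, ∃ g, IsPtLimit h g ∧ ∀ y, a t y = r * g y) :
    famRad μ n a ≤ r * famRad μ n h := by
  rw [famRad, famRad, ← integral_const_mul]
  refine integral_mono (integrable_signAvg μ ha hC') ((integrable_signAvg μ hh hC).const_mul r)
    fun z => ?_
  rw [mul_left_comm]
  refine mul_le_mul_of_nonneg_left ?_ (by positivity)
  rw [signAvg, signAvg, mul_left_comm, Finset.mul_sum _ _ r]
  refine mul_le_mul_of_nonneg_left (Finset.sum_le_sum fun ε _ => ciSup_le fun t => ?_)
    (by positivity)
  obtain ⟨g, hg, hag⟩ := hlim t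
  simp only [hag, mul_left_comm _ r, ← Finset.mul_sum]
  exact mul_le_mul_of_nonneg_left (hg.sum_sgn_mul_le hC ε z) hr

end Families

/-! ### The deterministic error bound. -/

section Estimate

variable {𝒵 𝒳 : Type*} [MeasurableSpace 𝒵] [MeasurableSpace 𝒳]

/-- If a bounded function has correlation at most `K` with each element of a symmetric class, and
its normalization is in the `κ`-span of the class, then its norm is at most `κ K`. -/
theorem l2norm_le_of_mem_spanK (μ : Measure 𝒵) [IsProbabilityMeasure μ] {X : 𝒵 → 𝒳}
    (hX : Measurable X) {𝒢 : Submodule ℝ (𝒳 → ℝ)} {S : Set 𝒢}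
    (hSm : ∀ f ∈ S, Measurable (f : 𝒳 → ℝ)) (hS1 : ∀ f ∈ S, ∀ x, |(f : 𝒳 → ℝ) x| ≤ 1)
    {b : 𝒳 → ℝ} {C K κ : ℝ} (hb : Measurable b) (hbC : ∀ x, |b x| ≤ C) (hK0 : 0 ≤ K)
    (hK : ∀ f ∈ S, |∫ z, b (X z) * (f : 𝒳 → ℝ) (X z) ∂μ| ≤ K) (hpos : 0 < l2norm μ X b)
    {g : 𝒳 → ℝ} (hg : g ∈ spanK κ S) (hbg : ∀ᵐ z ∂μ, b (X z) / l2norm μ X b = g (X z)) :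
    l2norm μ X b ≤ κ * K := by
  obtain ⟨w, f, hf, hw, hwκ, hsum⟩ := hg
  have hbX : Measurable fun z => b (X z) := hb.comp hX
  have hfX (i : ℕ) : Measurable fun z => (f i : 𝒳 → ℝ) (X z) := (hSm _ (hf i)).comp hX
  have hbf (i : ℕ) (z : 𝒵) : |w i * (b (X z) * (f i : 𝒳 → ℝ) (X z))| ≤ |w i| * C := by
    rw [abs_mul, abs_mul]
    gcongr
    exact (mul_le_of_le_one_right (abs_nonneg _) (hS1 _ (hf i) _)).trans (hbC _)
  have hint (i : ℕ) : Integrable (fun z => w i * (b (X z) * (f i : 𝒳 → ℝ) (X z))) μ :=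
    integrable_of_abs_le ((hbX.mul (hfX i)).const_mul _) (hbf i)
  have hnorm : Summable fun i => ∫ z, ‖w i * (b (X z) * (f i : 𝒳 → ℝ) (X z))‖ ∂μ := by
    refine Summable.of_nonneg_of_le (fun i => integral_nonneg fun z => norm_nonneg _) (fun i => ?_)
      (hw.mul_right C)
    refine (le_abs_self _).trans (abs_integral_le_of_abs_le fun z => ?_)
    rw [abs_norm]
    exact hbf i z
  -- Integration term by term is justified by ‖w‖₁ < ∞ and the boundedness of b and the f_i.
  have key := hasSum_integral_of_summable_integral_norm hint hnorm
  have hN : ∫ z, ∑' i, w i * (b (X z) * (f i : 𝒳 → ℝ) (X z)) ∂μ = l2norm μ X b := by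
    have h1 : ∀ᵐ z ∂μ, ∑' i, w i * (b (X z) * (f i : 𝒳 → ℝ) (X z)) =
        b (X z) ^ 2 / l2norm μ X b := by
      filter_upwards [hbg] with z hz
      have h2 := ((hsum (X z)).mul_left (b (X z))).tsum_eq
      simp only [mul_left_comm (b (X z))] at h2
      rw [h2, ← hz]
      ring
    rw [integral_congr_ae h1, integral_div, div_eq_iff hpos.ne', l2norm,
      Real.mul_self_sqrt (integral_nonneg fun z => sq_nonneg _)]
  rw [hN] at key
  have hle (i : ℕ) : ∫ z, w i * (b (X z) * (f i : 𝒳 → ℝ) (X z)) ∂μ ≤ |w i| * K := by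
    rw [integral_const_mul]
    refine (le_abs_self _).trans ?_
    rw [abs_mul]
    exact mul_le_mul_of_nonneg_left (hK _ (hf i)) (abs_nonneg _)
  refine (hasSum_le hle key (hw.hasSum.mul_right K)).trans ?_
  exact mul_le_mul_of_nonneg_right hwκ hK0

theorem empAvg_neg {α : Type*} {n : ℕ} (z : Fin n → α) (g : α → ℝ) :
    empAvg z (fun y => -g y) = -empAvg z g := by
  simp [empAvg]

/-- The deterministic part of the error bound: it holds for every sample on which the empirical
moments deviate from the population moments by at most `δ` at `a₀` and by at most `M + 2 δ`
uniformly over `𝒜`. -/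
theorem l2norm_sub_le_of_deviation_le (μ : Measure 𝒵) [IsProbabilityMeasure μ] {X : 𝒵 → 𝒳}
    (hX : Measurable X) {𝒢 V : Submodule ℝ (𝒳 → ℝ)} {m : 𝒵 → 𝒢 →ₗ[ℝ] ℝ} {S : Set 𝒢}
    (hne : S.Nonempty) (hneg : ∀ f ∈ S, -f ∈ S)
    (hSm : ∀ f ∈ S, Measurable (f : 𝒳 → ℝ) ∧ Measurable fun z => m z f)
    (hS1 : ∀ f ∈ S, (∀ x, |(f : 𝒳 → ℝ) x| ≤ 1) ∧ ∀ z, |m z f| ≤ 1)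
    {p : Seminorm ℝ V} {𝒜 : Set V} (hAm : ∀ a ∈ 𝒜, Measurable (a : 𝒳 → ℝ)) {a₀ : V}
    (ha₀ : a₀ ∈ 𝒜)
    (hriesz : ∀ f ∈ S, ∫ z, m z f ∂μ = ∫ z, (a₀ : 𝒳 → ℝ) (X z) * (f : 𝒳 → ℝ) (X z) ∂μ)
    (hA1 : ∀ a ∈ 𝒜, p a ≤ p a₀ + 1 → ∀ x, |(a : 𝒳 → ℝ) x| ≤ 1)
    {δ lam κ M : ℝ} (hδ : 0 < δ) (hlam : δ ≤ lam) (hκ : 1 ≤ κ) (hM : 0 ≤ M)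
    (hspan : ∀ a ∈ sub p 𝒜 ((p a₀ + δ / lam) ^ 2), δ ≤ l2norm μ X (a - a₀).1 →
      ∃ g ∈ spanK κ S, ∀ᵐ z ∂μ, (a - a₀).1 (X z) / l2norm μ X (a - a₀).1 = g (X z))
    {n : ℕ} {z : Fin n → 𝒵}
    (hdev₀ : ∀ f ∈ S,
      empAvg z (fun y => m y f - (a₀ : 𝒳 → ℝ) (X y) * (f : 𝒳 → ℝ) (X y)) ≤ δ)
    (hdev : ∀ f ∈ S, ∀ a ∈ 𝒜, p a ≤ p a₀ + 1 →
      ∫ y, (m y f - (a : 𝒳 → ℝ) (X y) * (f : 𝒳 → ℝ) (X y)) ∂μ ≤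
        empAvg z (fun y => m y f - (a : 𝒳 → ℝ) (X y) * (f : 𝒳 → ℝ) (X y)) + (M + 2 * δ))
    {a : V} (ha : IsEstimate X m S 𝒜 p lam z a) :
    l2norm μ X (a - a₀).1 ≤ κ * (M + 3 * δ + lam * (p a₀ - p a)) := by
  have hlam0 : 0 < lam := hδ.trans_le hlam
  have hcrit : ∀ f ∈ S, empAvg z (fun y => m y f - (a : 𝒳 → ℝ) (X y) * (f : 𝒳 → ℝ) (X y)) ≤
      δ + lam * (p a₀ - p a) := by
    intro f hf
    have h1 := ha.2 a₀ ha₀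
    simp only [criterion] at h1
    have h2 : sSup ((fun f : 𝒢 =>
        empAvg z fun y => m y f - (a₀ : 𝒳 → ℝ) (X y) * (f : 𝒳 → ℝ) (X y)) '' S) ≤ δ :=
      csSup_le (hne.image _) (by rintro _ ⟨f, hf, rfl⟩; exact hdev₀ f hf)
    -- No bound on the norm of a is available yet, so its values at the sample points are used.
    have h3 : BddAbove ((fun f : 𝒢 =>
        empAvg z fun y => m y f - (a : 𝒳 → ℝ) (X y) * (f : 𝒳 → ℝ) (X y)) '' S) := by
      refine ⟨(n : ℝ)⁻¹ * ∑ i, (1 + |(a : 𝒳 → ℝ) (X (z i))|), ?_⟩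
      rintro _ ⟨f, hf, rfl⟩
      refine mul_le_mul_of_nonneg_left (Finset.sum_le_sum fun i _ => ?_) (by positivity)
      refine (le_abs_self _).trans ((abs_sub _ _).trans (add_le_add ((hS1 f hf).2 _) ?_))
      rw [abs_mul]
      exact mul_le_of_le_one_right (abs_nonneg _) ((hS1 f hf).1 _)
    have h4 := le_csSup h3 ⟨f, hf, rfl⟩
    dsimp only at h4
    linarith
  -- The moments at f and -f are opposite, so adding the two bounds eliminates them.
  have hnorm : lam * p a ≤ lam * p a₀ + δ := by
    obtain ⟨f, hf⟩ := hne
    have h1 := hcrit f hf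
    have h2 := hcrit (-f) (hneg f hf)
    have h3 : (fun y => m y (-f) - (a : 𝒳 → ℝ) (X y) * ((-f : 𝒢) : 𝒳 → ℝ) (X y)) =
        fun y => -(m y f - (a : 𝒳 → ℝ) (X y) * (f : 𝒳 → ℝ) (X y)) := by
      funext y
      simp only [map_neg, Submodule.coe_neg, Pi.neg_apply]
      ring
    rw [h3, empAvg_neg] at h2
    linarith
  have hpa : p a ≤ p a₀ + δ / lam := by
    rw [← sub_le_iff_le_add', le_div_iff₀ hlam0]
    linarith
  have hpa1 : p a ≤ p a₀ + 1 := hpa.trans (by gcongr; exact (div_le_one hlam0).2 hlam)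
  set K := M + 3 * δ + lam * (p a₀ - p a) with hKdef
  -- By `hnorm` the penalty term is at least -δ, which 3δ absorbs. This settles the case where the
  -- error is below δ.
  have hKδ : δ ≤ K := by linarith
  have ham := hAm a ha.1
  have ha₀m := hAm a₀ ha₀
  have ha1 := hA1 a ha.1 hpa1
  have ha₀1 := hA1 a₀ ha₀ (by linarith)
  have hcorr : ∀ f ∈ S, ∫ y, (a₀ - a).1 (X y) * (f : 𝒳 → ℝ) (X y) ∂μ ≤ K := by
    intro f hf
    have hmul {c : 𝒳 → ℝ} (hc : Measurable c) (hc1 : ∀ x, |c x| ≤ 1) :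
        Integrable (fun y => c (X y) * (f : 𝒳 → ℝ) (X y)) μ := by
      refine integrable_of_abs_le (C := 1) ((hc.comp hX).mul ((hSm f hf).1.comp hX)) fun y => ?_
      rw [abs_mul]
      exact mul_le_one₀ (hc1 _) (abs_nonneg _) ((hS1 f hf).1 _)
    have h1 := hdev f hf a ha.1 hpa1
    rw [integral_sub (integrable_of_abs_le (hSm f hf).2 (hS1 f hf).2) (hmul ham ha1),
      hriesz f hf, ← integral_sub (hmul ha₀m ha₀1) (hmul ham ha1)] at h1
    have h2 := hcrit f hf
    simp only [← sub_mul] at h1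
    change ∫ y, ((a₀ : 𝒳 → ℝ) (X y) - (a : 𝒳 → ℝ) (X y)) * (f : 𝒳 → ℝ) (X y) ∂μ ≤ K
    linarith
  rcases lt_or_ge (l2norm μ X (a - a₀).1) δ with hlt | hge
  · exact (hlt.le.trans hKδ).trans (le_mul_of_one_le_left (hδ.le.trans hKδ) hκ)
  obtain ⟨g, hg, hga⟩ := hspan a ⟨ha.1, by gcongr⟩ hge
  refine l2norm_le_of_mem_spanK μ hX (fun f hf => (hSm f hf).1) (fun f hf => (hS1 f hf).1)
    (b := (a - a₀).1) (C := 2) (ham.sub ha₀m) (fun x => ?_) (hδ.le.trans hKδ) (fun f hf => ?_)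
    (hδ.trans_le hge) hg hga
  · change |(a : 𝒳 → ℝ) x - (a₀ : 𝒳 → ℝ) x| ≤ 2
    linarith [abs_sub ((a : 𝒳 → ℝ) x) ((a₀ : 𝒳 → ℝ) x), ha1 x, ha₀1 x]
  · have h1 := hcorr f hf
    have h2 := hcorr (-f) (hneg f hf)
    have h3 : ∀ y, (a₀ - a).1 (X y) = -(a - a₀).1 (X y) := fun y => by
      simp
    simp only [h3, Submodule.coe_neg, Pi.neg_apply, neg_mul, mul_neg, neg_neg,
      integral_neg] at h1 h2
    exact abs_le.2 ⟨by linarith, h2⟩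

end Estimate

/-! ### The high-probability event for one test class. -/

section Deviation

variable {𝒵 𝒳 : Type*} [MeasurableSpace 𝒵]

/-- With high probability the empirical moments are close to the population moments, at `a₀` and
uniformly over a ball of `𝒜`. -/
theorem exists_deviation_event [MeasurableSpace 𝒳] (μ : Measure 𝒵) [IsProbabilityMeasure μ] {X : 𝒵 → 𝒳}
    (hX : Measurable X) {𝒢 V : Submodule ℝ (𝒳 → ℝ)} {m : 𝒵 → 𝒢 →ₗ[ℝ] ℝ} {S : Set 𝒢}
    (hne : S.Nonempty) (hSm : ∀ f ∈ S, Measurable (f : 𝒳 → ℝ) ∧ Measurable fun z => m z f)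
    (hS1 : ∀ f ∈ S, (∀ x, |(f : 𝒳 → ℝ) x| ≤ 1) ∧ ∀ z, |m z f| ≤ 1)
    (hSsep : PointwiseSeparable ((fun f : 𝒢 => Sum.elim (f : 𝒳 → ℝ) fun z => m z f) '' S))
    {p : Seminorm ℝ V} {𝒜 : Set V} (hstar : StarConvex ℝ 0 𝒜)
    (hAm : ∀ a ∈ 𝒜, Measurable (a : 𝒳 → ℝ))
    (hAsep : ∀ r : ℝ, 1 ≤ r →
      PointwiseSeparable ((fun a : V => (a : 𝒳 → ℝ)) '' {a | a ∈ 𝒜 ∧ p a ≤ r}))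
    {r : ℝ} (hr : 1 ≤ r) (hA1 : ∀ a ∈ 𝒜, p a ≤ r → ∀ x, |(a : 𝒳 → ℝ) x| ≤ 1)
    {a₀ : V} (ha₀ : a₀ ∈ 𝒜) (ha₀r : p a₀ ≤ r) {n : ℕ} (hn : 0 < n) {s : ℝ} (hs : 0 ≤ s) :
    ∃ B : Set (Fin n → 𝒵), MeasurableSet B ∧
      (Measure.pi fun _ => μ).real B ≤ 2 * Real.exp (-s ^ 2 * n / 32) ∧
      ∀ z ∉ B, (∀ f ∈ S,
        ∫ y, (m y f - (a₀ : 𝒳 → ℝ) (X y) * (f : 𝒳 → ℝ) (X y)) ∂μ ≤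
          empAvg z (fun y => m y f - (a₀ : 𝒳 → ℝ) (X y) * (f : 𝒳 → ℝ) (X y)) +
            (2 * (rademacher μ n (compX X S) + rademacher μ n (mComp m S)) + s)) ∧
        ∀ f ∈ S, ∀ a ∈ 𝒜, p a ≤ r →
          ∫ y, (m y f - (a : 𝒳 → ℝ) (X y) * (f : 𝒳 → ℝ) (X y)) ∂μ ≤
            empAvg z (fun y => m y f - (a : 𝒳 → ℝ) (X y) * (f : 𝒳 → ℝ) (X y)) +
              (4 * r * rademacher μ n (compX X (sub p 𝒜 1)) +
                (4 * rademacher μ n (compX X S) + 2 * rademacher μ n (mComp m S)) + s) := by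
  obtain ⟨D, hDS, hDc, hDlim⟩ := hSsep.exists_countable
  obtain ⟨E, hEA, hEc, hElim⟩ := (hAsep r hr).exists_countable
  obtain ⟨E₁, hE₁A, hE₁c, hE₁lim⟩ := (hAsep 1 le_rfl).exists_countable
  have := hDc.to_subtype
  have := hEc.to_subtype
  have := hE₁c.to_subtype
  obtain ⟨f₀, hf₀⟩ := hne
  have : Nonempty D := ⟨(hDlim f₀ hf₀).choose 0⟩
  have : Nonempty E := ⟨(hElim a₀ ⟨ha₀, ha₀r⟩).choose 0⟩
  have h0A : (0 : V) ∈ {a | a ∈ 𝒜 ∧ p a ≤ 1} := by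
    refine ⟨?_, by simp⟩
    simpa using hstar ha₀ zero_le_one le_rfl (by norm_num)
  have : Nonempty E₁ := ⟨(hE₁lim 0 h0A).choose 0⟩
  let M : D → 𝒵 → ℝ := fun t z => m z t
  let f : D → 𝒵 → ℝ := fun t z => (t.1 : 𝒳 → ℝ) (X z)
  let α : E → 𝒵 → ℝ := fun t z => (t.1 : 𝒳 → ℝ) (X z)
  let α₁ : E₁ → 𝒵 → ℝ := fun t z => (t.1 : 𝒳 → ℝ) (X z)
  let α₀ : 𝒵 → ℝ := fun z => (a₀ : 𝒳 → ℝ) (X z)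
  have hMm (t : D) : Measurable (M t) := (hSm _ (hDS t.2)).2
  have hfm (t : D) : Measurable (f t) := (hSm _ (hDS t.2)).1.comp hX
  have hαm (t : E) : Measurable (α t) := (hAm _ (hEA t.2).1).comp hX
  have hα₁m (t : E₁) : Measurable (α₁ t) := (hAm _ (hE₁A t.2).1).comp hX
  have hα₀m : Measurable α₀ := (hAm _ ha₀).comp hX
  have hM1 (t : D) (z : 𝒵) : |M t z| ≤ 1 := (hS1 _ (hDS t.2)).2 z
  have hf1 (t : D) (z : 𝒵) : |f t z| ≤ 1 := (hS1 _ (hDS t.2)).1 (X z)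
  have hα1 (t : E) (z : 𝒵) : |α t z| ≤ 1 := hA1 _ (hEA t.2).1 (hEA t.2).2 (X z)
  have hα₁1 (t : E₁) (z : 𝒵) : |α₁ t z| ≤ 1 :=
    hA1 _ (hE₁A t.2).1 ((hE₁A t.2).2.trans hr) (X z)
  have hα₀1 (z : 𝒵) : |α₀ z| ≤ 1 := hA1 _ ha₀ ha₀r (X z)
  have hsubmul {x y w : ℝ} (hx : |x| ≤ 1) (hy : |y| ≤ 1) (hw : |w| ≤ 1) : |x - y * w| ≤ 2 := by
    have := mul_le_one₀ hy (abs_nonneg w) hw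
    rw [← abs_mul] at this
    linarith [abs_sub x (y * w)]
  have hRf : rademacher μ n (compX X S) = famRad μ n f := by
    refine rademacher_eq_famRad μ hf1 (fun t => ⟨t, hDS t.2, rfl⟩) ?_
    rintro _ ⟨b, hb, rfl⟩
    obtain ⟨u, hu⟩ := hDlim b hb
    exact ⟨u, fun z => by simpa using hu (.inl (X z))⟩
  have hRM : rademacher μ n (mComp m S) = famRad μ n M := by
    refine rademacher_eq_famRad μ hM1 (fun t => ⟨t, hDS t.2, rfl⟩) ?_
    rintro _ ⟨b, hb, rfl⟩
    obtain ⟨u, hu⟩ := hDlim b hb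
    exact ⟨u, fun z => by simpa using hu (.inr z)⟩
  have hsub1 : sub p 𝒜 1 = {a | a ∈ 𝒜 ∧ p a ≤ 1} := by
    ext a
    exact and_congr_right fun _ => sq_le_one_iff₀ (apply_nonneg p a)
  have hRα₁ : rademacher μ n (compX X (sub p 𝒜 1)) = famRad μ n α₁ := by
    rw [hsub1]
    refine rademacher_eq_famRad μ hα₁1 (fun t => ⟨t, hE₁A t.2, rfl⟩) ?_
    rintro _ ⟨b, hb, rfl⟩
    obtain ⟨u, hu⟩ := hE₁lim b hb
    exact ⟨u, fun z => hu (X z)⟩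
  have hr0 : 0 < r := one_pos.trans_le hr
  have hα : famRad μ n α ≤ r * famRad μ n α₁ := by
    refine famRad_le_mul μ hr0.le hα₁m hα₁1 hαm hα1 fun t => ?_
    -- Star-convexity and r ≥ 1 put the rescaled function in the unit ball.
    have hmem : r⁻¹ • (t : V) ∈ {a | a ∈ 𝒜 ∧ p a ≤ 1} := by
      refine ⟨hstar.smul_mem (hEA t.2).1 (by positivity) (inv_le_one_of_one_le₀ hr), ?_⟩
      rw [map_smul_eq_mul, Real.norm_of_nonneg (by positivity), inv_mul_le_iff₀ hr0, mul_one]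
      exact (hEA t.2).2
    obtain ⟨u, hu⟩ := hE₁lim _ hmem
    refine ⟨fun z => ((r⁻¹ • (t : V) : V) : 𝒳 → ℝ) (X z), ⟨u, fun z => hu (X z)⟩, fun z => ?_⟩
    simp [α, hr0.ne']
  let h₀ : D → 𝒵 → ℝ := fun t y => M t y - α₀ y * f t y
  let h₁ : E × D → 𝒵 → ℝ := fun t y => M t.2 y - α t.1 y * f t.2 y
  have hh₀ (t : D) : Measurable (h₀ t) := (hMm t).sub (hα₀m.mul (hfm t))
  have hh₁ (t : E × D) : Measurable (h₁ t) := (hMm t.2).sub ((hαm t.1).mul (hfm t.2))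
  have hC₀ (t : D) (y : 𝒵) : |h₀ t y| ≤ 2 := hsubmul (hM1 t y) (hα₀1 y) (hf1 t y)
  have hC₁ (t : E × D) (y : 𝒵) : |h₁ t y| ≤ 2 := hsubmul (hM1 t.2 y) (hα1 t.1 y) (hf1 t.2 y)
  have hR₀ := famRad_sub_mul_le (n := n) μ hMm hfm hα₀m hM1 hf1 hα₀1
  have hR₁ := famRad_sub_mul_prod_le (n := n) μ hMm hfm hαm hM1 hf1 hα1
  have hP₀ := measure_empDev_ge_le (n := n) μ hn hh₀ hC₀ (by norm_num) hs
  have hP₁ := measure_empDev_ge_le (n := n) μ hn hh₁ hC₁ (by norm_num) hs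
  refine ⟨{z | 2 * famRad μ n h₀ + s ≤ empDev μ h₀ z} ∪
    {z | 2 * famRad μ n h₁ + s ≤ empDev μ h₁ z},
    (measurableSet_le measurable_const (measurable_empDev μ hh₀)).union
      (measurableSet_le measurable_const (measurable_empDev μ hh₁)), ?_, fun z hz => ?_⟩
  · refine (measureReal_union_le _ _).trans ?_
    norm_num at hP₀ hP₁ ⊢
    linarith
  have hz₀ : empDev μ h₀ z < 2 * famRad μ n h₀ + s := not_le.1 fun h => hz (.inl h)
  have hz₁ : empDev μ h₁ z < 2 * famRad μ n h₁ + s := not_le.1 fun h => hz (.inr h)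
  rw [hRf, hRM, hRα₁]
  refine ⟨fun b hb => ?_, fun b hb a ha har => ?_⟩
  · obtain ⟨u, hu⟩ := hDlim b hb
    have hlim : IsPtLimit h₀ fun y => m y b - (a₀ : 𝒳 → ℝ) (X y) * (b : 𝒳 → ℝ) (X y) :=
      ⟨u, fun y => (hu (.inr y)).sub ((hu (.inl (X y))).const_mul _)⟩
    have := hlim.integral_sub_empAvg_le μ hn hh₀ hC₀ z
    linarith
  · obtain ⟨u, hu⟩ := hDlim b hb
    obtain ⟨v, hv⟩ := hElim a ⟨ha, har⟩
    have hlim : IsPtLimit h₁ fun y => m y b - (a : 𝒳 → ℝ) (X y) * (b : 𝒳 → ℝ) (X y) :=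
      ⟨fun k => (v k, u k), fun y => (hu (.inr y)).sub ((hv (X y)).mul (hu (.inl (X y))))⟩
    have := hlim.integral_sub_empAvg_le μ hn hh₁ hC₁ z
    linarith

theorem rademacher_compX_nonneg (μ : Measure 𝒵) (X : 𝒵 → 𝒳) {V : Submodule ℝ (𝒳 → ℝ)} {S : Set V}
    {f : V} (hf : f ∈ S) (hneg : -f ∈ S) (n : ℕ) : 0 ≤ rademacher μ n (compX X S) :=
  rademacher_nonneg_of_neg_mem μ ⟨f, hf, rfl⟩ ⟨-f, hneg, by ext; simp⟩

theorem rademacher_mComp_nonneg (μ : Measure 𝒵) {𝒢 : Submodule ℝ (𝒳 → ℝ)} (m : 𝒵 → 𝒢 →ₗ[ℝ] ℝ)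
    {S : Set 𝒢} {f : 𝒢} (hf : f ∈ S) (hneg : -f ∈ S) (n : ℕ) : 0 ≤ rademacher μ n (mComp m S) :=
  rademacher_nonneg_of_neg_mem μ ⟨f, hf, rfl⟩ ⟨-f, hneg, by ext; simp⟩

/-- The choice of constants that turns a union bound over `2 d` events into level `ζ`. -/
theorem exp_neg_sq_mul_le {d n : ℕ} (hd : 0 < d) (hn : 0 < n) {ζ : ℝ} (hζ0 : 0 < ζ)
    (hζ1 : ζ < 1) :
    0 < 6 * √(Real.log (2 * d / ζ) / n) ∧
      2 * Real.exp (-(6 * √(Real.log (2 * d / ζ) / n)) ^ 2 * n / 32) ≤ ζ / d := by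
  have hd' : (1 : ℝ) ≤ d := Nat.one_le_cast.2 hd
  have hn' : (0 : ℝ) < n := Nat.cast_pos.2 hn
  have hlog : 0 < Real.log (2 * d / ζ) := by
    refine Real.log_pos ?_
    rw [lt_div_iff₀ hζ0]
    linarith
  refine ⟨by positivity, ?_⟩
  -- 6² = 36 exceeds the 32 of the deviation bound.
  have h1 : -(6 * √(Real.log (2 * d / ζ) / n)) ^ 2 * n / 32 ≤ -Real.log (2 * d / ζ) := by
    rw [mul_pow, Real.sq_sqrt (by positivity)]
    field_simp
    linarith
  have h2 := Real.exp_le_exp.2 h1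
  rw [Real.exp_neg, Real.exp_log (by positivity)] at h2
  refine (mul_le_mul_of_nonneg_left h2 two_pos.le).trans (le_of_eq ?_)
  field_simp

end Deviation

end AdvRiesz

/-! ### The theorem: union bound over the test classes. -/

theorem theorem2 :
    ∃ c₀ c₁ : ℝ, 0 < c₀ ∧ 1 ≤ c₁ ∧
      ∀ {𝒵 𝒳 Ω : Type*} [MeasurableSpace 𝒵] [MeasurableSpace 𝒳] [MeasurableSpace Ω]
        -- the law of `Z` and the covariates `X`, a measurable function of `Z`
        (μ : Measure 𝒵) [IsProbabilityMeasure μ] (X : 𝒵 → 𝒳) (_ : Measurable X)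
        -- the moment function, linear in its functional argument
        (𝒢 : Submodule ℝ (𝒳 → ℝ)) (m : 𝒵 → 𝒢 →ₗ[ℝ] ℝ)
        -- the symmetric test classes
        (d : ℕ) (_ : 0 < d) (F : Fin d → Set 𝒢)
        (_ : ∀ i, (F i).Nonempty) (_ : ∀ i, ∀ f ∈ F i, -f ∈ F i)
        (_ : ∀ i, ∀ f ∈ F i, Measurable (f : 𝒳 → ℝ) ∧ Measurable fun z => m z f)
        (_ : ∀ i, ∀ f ∈ F i, (∀ x, |(f : 𝒳 → ℝ) x| ≤ 1) ∧ ∀ z, |m z f| ≤ 1)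
        (_ : ∀ i, AdvRiesz.PointwiseSeparable
          ((fun f : 𝒢 => Sum.elim (f : 𝒳 → ℝ) fun z => m z f) '' F i))
        -- the star-convex space `𝒜` with its norm
        (V : Submodule ℝ (𝒳 → ℝ)) (p : Seminorm ℝ V) (𝒜 : Set V) (_ : StarConvex ℝ 0 𝒜)
        (_ : ∀ a ∈ 𝒜, Measurable (a : 𝒳 → ℝ))
        (_ : ∀ r : ℝ, 1 ≤ r →
          AdvRiesz.PointwiseSeparable ((fun a : V => (a : 𝒳 → ℝ)) '' {a | a ∈ 𝒜 ∧ p a ≤ r}))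
        -- the Riesz representer
        (a₀ : V) (_ : a₀ ∈ 𝒜)
        (_ : ∀ i, ∀ f ∈ F i,
          ∫ z, m z f ∂μ = ∫ z, (a₀ : 𝒳 → ℝ) (X z) * (f : 𝒳 → ℝ) (X z) ∂μ)
        (_ : ∀ a ∈ 𝒜, p a ≤ p a₀ + 1 → ∀ x, |(a : 𝒳 → ℝ) x| ≤ 1)
        -- the i.i.d. sample
        (P : Measure Ω) [IsProbabilityMeasure P] (n : ℕ) (_ : 0 < n)
        (Z : Fin n → Ω → 𝒵) (_ : ∀ j, Measurable (Z j)) (_ : iIndepFun Z P)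
        (_ : ∀ j, P.map (Z j) = μ)
        -- confidence level, penalty level, and the span condition
        (ζ : ℝ) (_ : 0 < ζ) (_ : ζ < 1)
        (lam : ℝ) (_ : AdvRiesz.delta μ X m F n ζ c₀ c₁ ≤ lam)
        (κ : ℝ) (_ : 1 ≤ κ)
        (_ : ∀ a ∈ AdvRiesz.sub p 𝒜 ((p a₀ + AdvRiesz.delta μ X m F n ζ c₀ c₁ / lam) ^ 2),
          AdvRiesz.delta μ X m F n ζ c₀ c₁ ≤ AdvRiesz.l2norm μ X (a - a₀).1 →
          ∃ g ∈ AdvRiesz.spanK κ (⋃ i, F i),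
            ∀ᵐ z ∂μ, (a - a₀).1 (X z) / AdvRiesz.l2norm μ X (a - a₀).1 = g (X z))
        -- the estimator
        (ahat : Ω → V)
        (_ : ∀ᵐ ω ∂P,
          AdvRiesz.IsEstimate X m (⋃ i, F i) 𝒜 p lam (fun j => Z j ω) (ahat ω)),
        -- with probability at least `1 - ζ`: the failure event has outer probability at most `ζ`
        P {ω | ¬ AdvRiesz.l2norm μ X (ahat ω - a₀).1 ≤
          κ * (4 * (p a₀ + 1) * AdvRiesz.rademacher μ n (AdvRiesz.compX X (AdvRiesz.sub p 𝒜 1)) +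
            3 * AdvRiesz.delta μ X m F n ζ c₀ c₁ + lam * (p a₀ - p (ahat ω)))}
          ≤ ENNReal.ofReal ζ := by
  -- The 2 in c₁ counts the two bad events of each class.
  refine ⟨6, 2, by norm_num, by norm_num, ?_⟩
  intro 𝒵 𝒳 Ω _ _ _ μ _ X hX 𝒢 m d hd F hFne hFneg hFm hF1 hFsep V p 𝒜 hstar hAm hAsep a₀ ha₀
    hriesz hA1 P _ n hn Z hZ hind hlaw ζ hζ0 hζ1 lam hlam κ hκ hspan ahat hahat
  obtain ⟨hs, hexp⟩ := AdvRiesz.exp_neg_sq_mul_le hd hn hζ0 hζ1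
  set δ := AdvRiesz.delta μ X m F n ζ 6 2 with hδdef
  set s := 6 * √(Real.log (2 * d / ζ) / n) with hsdef
  have hRf (i : Fin d) : 0 ≤ AdvRiesz.rademacher μ n (AdvRiesz.compX X (F i)) := by
    obtain ⟨f, hf⟩ := hFne i
    exact AdvRiesz.rademacher_compX_nonneg μ X hf (hFneg i f hf) n
  have hRm (i : Fin d) : 0 ≤ AdvRiesz.rademacher μ n (AdvRiesz.mComp m (F i)) := by
    obtain ⟨f, hf⟩ := hFne i
    exact AdvRiesz.rademacher_mComp_nonneg μ m hf (hFneg i f hf) n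
  have hδi (i : Fin d) : 2 * (AdvRiesz.rademacher μ n (AdvRiesz.compX X (F i)) +
      AdvRiesz.rademacher μ n (AdvRiesz.mComp m (F i))) + s ≤ δ := by
    have := le_ciSup (f := fun i : Fin d => AdvRiesz.rademacher μ n (AdvRiesz.compX X (F i)) +
      AdvRiesz.rademacher μ n (AdvRiesz.mComp m (F i))) (Set.finite_range _).bddAbove i
    rw [hδdef, AdvRiesz.delta, ← hsdef]
    linarith
  have hδ : 0 < δ := by linarith [hδi ⟨0, hd⟩, hRf ⟨0, hd⟩, hRm ⟨0, hd⟩]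
  have hp0 : 0 ≤ p a₀ := apply_nonneg p a₀
  -- 𝒜 need not be symmetric; nonnegativity of its complexity comes from 0 = -0.
  have h0A : (0 : V) ∈ AdvRiesz.sub p 𝒜 1 := by
    refine ⟨?_, by simp⟩
    simpa using hstar ha₀ zero_le_one le_rfl (by norm_num)
  have hRA := AdvRiesz.rademacher_compX_nonneg μ X h0A (by simpa using h0A) n
  choose B hBm hBP hB using fun i => AdvRiesz.exists_deviation_event μ hX (hFne i) (hFm i) (hF1 i)
    (hFsep i) hstar hAm hAsep (by linarith : 1 ≤ p a₀ + 1) hA1 ha₀ (by linarith) hn hs.le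
  have hmap : P.map (fun ω j => Z j ω) = Measure.pi fun _ => μ := by
    rw [(iIndepFun_iff_map_fun_eq_pi_map fun j => (hZ j).aemeasurable).1 hind]
    simp only [hlaw]
  have hbad : P {ω | (fun j => Z j ω) ∈ ⋃ i, B i} ≤ ENNReal.ofReal ζ := by
    have h1 : P {ω | (fun j => Z j ω) ∈ ⋃ i, B i} = (Measure.pi fun _ => μ) (⋃ i, B i) := by
      rw [← hmap, Measure.map_apply (measurable_pi_lambda _ hZ) (MeasurableSet.iUnion hBm)]
      rfl
    rw [h1, ← ofReal_measureReal]
    refine ENNReal.ofReal_le_ofReal ((measureReal_iUnion_fintype_le _).trans ?_)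
    refine (Finset.sum_le_card_nsmul _ _ (ζ / d) fun i _ => (hBP i).trans hexp).trans (le_of_eq ?_)
    have : (d : ℝ) ≠ 0 := by positivity
    simp only [Finset.card_univ, Fintype.card_fin, nsmul_eq_mul]
    field_simp
  -- The failure set may be non-measurable; it lies almost surely in the measurable bad event.
  refine (measure_mono_ae ?_).trans hbad
  filter_upwards [hahat] with ω hω hfail
  by_contra hgood
  refine hfail ?_
  have hz (i : Fin d) : (fun j => Z j ω) ∉ B i := fun h => hgood (Set.mem_iUnion.2 ⟨i, h⟩)
  refine AdvRiesz.l2norm_sub_le_of_deviation_le μ hX (S := ⋃ i, F i)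
    ((hFne ⟨0, hd⟩).mono (Set.subset_iUnion F _)) ?_ ?_ ?_ hAm ha₀ ?_ hA1 hδ hlam hκ
    (M := 4 * (p a₀ + 1) * AdvRiesz.rademacher μ n (AdvRiesz.compX X (AdvRiesz.sub p 𝒜 1)))
    (by positivity) hspan ?_ ?_ hω
  · intro f hf
    obtain ⟨i, hi⟩ := Set.mem_iUnion.1 hf
    exact Set.mem_iUnion.2 ⟨i, hFneg i f hi⟩
  · intro f hf
    obtain ⟨i, hi⟩ := Set.mem_iUnion.1 hf
    exact hFm i f hi
  · intro f hf
    obtain ⟨i, hi⟩ := Set.mem_iUnion.1 hf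
    exact hF1 i f hi
  · intro f hf
    obtain ⟨i, hi⟩ := Set.mem_iUnion.1 hf
    exact hriesz i f hi
  · intro f hf
    obtain ⟨i, hi⟩ := Set.mem_iUnion.1 hf
    -- The event bounds population minus empirical moments; using -f reverses this, and the
    -- population moment at a₀ vanishes.
    have h1 := (hB i _ (hz i)).1 (-f) (hFneg i f hi)
    have ha₀1 := hA1 a₀ ha₀ (by linarith)
    have h2 : (fun y => m y (-f) - (a₀ : 𝒳 → ℝ) (X y) * ((-f : 𝒢) : 𝒳 → ℝ) (X y)) =
        fun y => -(m y f - (a₀ : 𝒳 → ℝ) (X y) * (f : 𝒳 → ℝ) (X y)) := by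
      funext y
      simp only [map_neg, Submodule.coe_neg, Pi.neg_apply]
      ring
    have h3 : Integrable (fun y => (a₀ : 𝒳 → ℝ) (X y) * (f : 𝒳 → ℝ) (X y)) μ := by
      refine AdvRiesz.integrable_of_abs_le (C := 1)
        (((hAm a₀ ha₀).comp hX).mul ((hFm i f hi).1.comp hX)) fun y => ?_
      rw [abs_mul]
      exact mul_le_one₀ (ha₀1 _) (abs_nonneg _) ((hF1 i f hi).1 _)
    rw [h2, AdvRiesz.empAvg_neg, integral_neg, integral_sub
      (AdvRiesz.integrable_of_abs_le (hFm i f hi).2 (hF1 i f hi).2) h3, hriesz i f hi,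
      sub_self, neg_zero] at h1
    linarith [hδi i]
  · intro f hf a ha hpa
    obtain ⟨i, hi⟩ := Set.mem_iUnion.1 hf
    have h1 := (hB i _ (hz i)).2 f hi a ha hpa
    -- 4R(F) + 2R(m ∘ F) + s ≤ 2(2R(F) + 2R(m ∘ F) + s) ≤ 2δ.
    linarith [hδi i, hRf i, hRm i]
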